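/- Let $H$ be a Hilbert space over $\mathbb F\in\{\mathbb R,\mathbb C\}$ with $\dim H\ge 3$. Let $[0,I]$ be the set of all bounded self-adjoint operators $A$ on $H$ with $0\le A\le I$, where $A\le B$ means that $\langle (B-A)x,x\rangle\ge 0$ for all $x\in H$. An order automorphism of $[0,I]$ is a bijection $\phi:[0,I]\to[0,I]$ such that $X\le Y\iff\phi(X)\le\phi(Y)$ for all $X,Y\in[0,I]$. A bounded semilinear operator on $H$ is a continuous map $T:H\to H$ that is linear if $\mathbb F=\mathbb R$, and linear or conjugate-linear if $\mathbb F=\mathbb C$. Its adjoint $T^*$ is the usual one if $T$ is linear; if $T$ is conjugate-linear, $T^*$ is the unique bounded conjugate-linear operator with $\langle Tx,y\rangle=\overline{\langle x,T^*y\rangle}$ for all $x,y\in H$. 1. For every bijective bounded semilinear operator $T:H\to H$ and every $X\in[0,I]$, the operator $X(T^*T-I)+I$ is invertible in the algebra of bounded linear operators on $H$, and $$\phi_T(X)=T\left(X(T^*T-I)+I\right)^{-1}XT^*$$ belongs to $[0,I]$. 2. A map $\phi:[0,I]\to[0,I]$ is an order automorphism if and only if there exists a bijective bounded semilinear operator $T:H\to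 H$ such that $\phi(X)=\phi_T(X)$ for every $X\in[0,I]$. 3. If $T,S:H\to H$ are bijective bounded semilinear operators with $\phi_T(X)=\phi_S(X)$ for every $X\in[0,I]$, then $T=cS$ for some $c\in\mathbb F$ with $|c|=1$. -/

import Mathlib

open scoped InnerProductSpace

/-- The field automorphism `σ` of `𝕜` is the identity or complex conjugation. -/
class IsIdOrConj {𝕜 : Type*} [RCLike 𝕜] (σ : 𝕜 →+* 𝕜) : Prop where
  eq_id_or_conj : σ = RingHom.id 𝕜 ∨ σ = starRingEnd 𝕜

instance isIdOrConj_id {𝕜 : Type*} [RCLike 𝕜] : IsIdOrConj (RingHom.id 𝕜) := ⟨Or.inl rfl⟩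

instance isIdOrConj_conj {𝕜 : Type*} [RCLike 𝕜] : IsIdOrConj (starRingEnd 𝕜) := ⟨Or.inr rfl⟩

theorem IsIdOrConj.apply_apply {𝕜 : Type*} [RCLike 𝕜] (σ : 𝕜 →+* 𝕜) [h : IsIdOrConj σ] (c : 𝕜) :
    σ (σ c) = c := by
  rcases h.eq_id_or_conj with h | h <;> simp [h]

theorem IsIdOrConj.norm_apply {𝕜 : Type*} [RCLike 𝕜] (σ : 𝕜 →+* 𝕜) [h : IsIdOrConj σ] (c : 𝕜) :
    ‖σ c‖ = ‖c‖ := by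
  rcases h.eq_id_or_conj with h | h <;> simp [h]

theorem IsIdOrConj.apply_conj {𝕜 : Type*} [RCLike 𝕜] (σ : 𝕜 →+* 𝕜) [h : IsIdOrConj σ] (c : 𝕜) :
    σ (starRingEnd 𝕜 c) = starRingEnd 𝕜 (σ c) := by
  rcases h.eq_id_or_conj with h | h <;> simp [h]

instance IsIdOrConj.ringHomInvPair {𝕜 : Type*} [RCLike 𝕜] (σ : 𝕜 →+* 𝕜) [IsIdOrConj σ] :
    RingHomInvPair σ σ where
  comp_eq := RingHom.ext (IsIdOrConj.apply_apply σ)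
  comp_eq₂ := RingHom.ext (IsIdOrConj.apply_apply σ)

instance IsIdOrConj.ringHomIsometric {𝕜 : Type*} [RCLike 𝕜] (σ : 𝕜 →+* 𝕜) [IsIdOrConj σ] :
    RingHomIsometric σ where
  norm_map := IsIdOrConj.norm_apply σ _

noncomputable section

/-- For a bounded `σ`-semilinear `T` and a vector `y`, the bounded linear functional
`x ↦ σ ⟪y, T x⟫`. -/
def semiFunctional {𝕜 H : Type*} [RCLike 𝕜] [NormedAddCommGroup H] [InnerProductSpace 𝕜 H]
    {σ : 𝕜 →+* 𝕜} [IsIdOrConj σ] (T : H →SL[σ] H) (y : H) : StrongDual 𝕜 H :=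
  LinearMap.mkContinuous
    { toFun := fun x => σ ⟪y, T x⟫_𝕜
      map_add' := fun x z => by simp [inner_add_right]
      map_smul' := fun c x => by
        simp [inner_smul_right, IsIdOrConj.apply_apply σ] }
    (‖T‖ * ‖y‖) (fun x => by
      change ‖σ ⟪y, T x⟫_𝕜‖ ≤ _
      rw [IsIdOrConj.norm_apply σ]
      calc ‖⟪y, T x⟫_𝕜‖ ≤ ‖y‖ * ‖T x‖ := norm_inner_le_norm _ _
        _ ≤ ‖y‖ * (‖T‖ * ‖x‖) := by gcongr; exact T.le_opNorm x
        _ = ‖T‖ * ‖y‖ * ‖x‖ := by ring)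

theorem inner_toDual_semiFunctional {𝕜 H : Type*} [RCLike 𝕜] [NormedAddCommGroup H]
    [InnerProductSpace 𝕜 H] [CompleteSpace H]
    {σ : 𝕜 →+* 𝕜} [IsIdOrConj σ] (T : H →SL[σ] H) (x y : H) :
    ⟪(InnerProductSpace.toDual 𝕜 H).symm (semiFunctional T y), x⟫_𝕜 = σ ⟪y, T x⟫_𝕜 := by
  rw [InnerProductSpace.toDual_symm_apply]
  rfl

/-- The adjoint of a bounded linear or conjugate-linear operator `T`: the bounded operator,
semilinear with respect to the same `σ`, given by the Riesz representation theorem and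
characterized by `⟪T x, y⟫ = σ ⟪x, T* y⟫`. -/
def semiAdjoint {𝕜 H : Type*} [RCLike 𝕜] [NormedAddCommGroup H] [InnerProductSpace 𝕜 H]
    [CompleteSpace H] {σ : 𝕜 →+* 𝕜} [IsIdOrConj σ] (T : H →SL[σ] H) : H →SL[σ] H :=
  LinearMap.mkContinuous
    { toFun := fun y => (InnerProductSpace.toDual 𝕜 H).symm (semiFunctional T y)
      map_add' := fun y z => by
        refine ext_inner_right 𝕜 fun x => ?_
        simp only [inner_add_left, inner_toDual_semiFunctional, map_add]
      map_smul' := fun c y => by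
        refine ext_inner_right 𝕜 fun x => ?_
        simp only [inner_smul_left, inner_toDual_semiFunctional, map_mul,
          IsIdOrConj.apply_conj σ] }
    ‖T‖ (fun y => by
      change ‖(InnerProductSpace.toDual 𝕜 H).symm (semiFunctional T y)‖ ≤ _
      rw [LinearIsometryEquiv.norm_map]
      exact LinearMap.mkContinuous_norm_le _ (by positivity) _)

theorem inner_semiAdjoint {𝕜 H : Type*} [RCLike 𝕜] [NormedAddCommGroup H]
    [InnerProductSpace 𝕜 H] [CompleteSpace H]
    {σ : 𝕜 →+* 𝕜} [IsIdOrConj σ] (T : H →SL[σ] H) (x y : H) :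
    ⟪T x, y⟫_𝕜 = σ ⟪x, semiAdjoint T y⟫_𝕜 := by
  rw [← inner_conj_symm x, ← inner_conj_symm (T x), IsIdOrConj.apply_conj σ]
  congr 1
  refine Eq.trans ?_ (congrArg σ (inner_toDual_semiFunctional T x y)).symm
  rw [IsIdOrConj.apply_apply σ]

/-- For linear operators the adjoint above is the usual one. -/
theorem semiAdjoint_eq_adjoint {𝕜 H : Type*} [RCLike 𝕜] [NormedAddCommGroup H]
    [InnerProductSpace 𝕜 H] [CompleteSpace H] (T : H →L[𝕜] H) :
    semiAdjoint T = ContinuousLinearMap.adjoint T := by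
  ext y
  refine ext_inner_left 𝕜 fun x => ?_
  rw [ContinuousLinearMap.adjoint_inner_right]
  exact (inner_semiAdjoint T x y).symm

/-- The operator `X (T* T - I) + I`. -/
def effectDenom {𝕜 H : Type*} [RCLike 𝕜] [NormedAddCommGroup H] [InnerProductSpace 𝕜 H]
    [CompleteSpace H] {σ : 𝕜 →+* 𝕜} [IsIdOrConj σ] (T : H →SL[σ] H) (X : H →L[𝕜] H) :
    H →L[𝕜] H :=
  X * ((semiAdjoint T).comp T - 1) + 1

/-- The operator `φ_T(X) = T (X (T* T - I) + I)⁻¹ X T*`. -/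
def effectMap {𝕜 H : Type*} [RCLike 𝕜] [NormedAddCommGroup H] [InnerProductSpace 𝕜 H]
    [CompleteSpace H] {σ : 𝕜 →+* 𝕜} [IsIdOrConj σ] (T : H →SL[σ] H) (X : H →L[𝕜] H) :
    H →L[𝕜] H :=
  T.comp ((Ring.inverse (effectDenom T X) * X).comp (semiAdjoint T))

end

/-- The effect algebra `[0, I]`. The order on operators is `A ≤ B ↔ (B - A)` is self-adjoint and
positive, so that members are automatically self-adjoint. -/
abbrev effects (𝕜 H : Type*) [RCLike 𝕜] [NormedAddCommGroup H] [InnerProductSpace 𝕜 H] :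
    Set (H →L[𝕜] H) :=
  Set.Icc 0 1

/-- An order automorphism of a set `M` of operators: a bijection that preserves the order in both
directions. -/
def IsOrderAutomorphism {α : Type*} [PartialOrder α] {M : Set α} (φ : M → M) : Prop :=
  Function.Bijective φ ∧ ∀ X Y : M, X ≤ Y ↔ φ X ≤ φ Y

/-! For invertible `X`, call the value at `x` of the form of `X⁻¹ - I` the energy of `X` at `x`.
Then `rankOne 𝕜 x u ≤ X` holds exactly when this energy is at most `u`, and every effect is the
supremum of the rank one effects below it, so energies encode the order. Since `φ_T(X)⁻¹ - I =
(T⁻¹)* (X⁻¹ - I) T⁻¹`, the map `φ_T` transports the energy at `x` to `T x`; in particular it sends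
`rankOne 𝕜 x u` to `rankOne 𝕜 (T x) u` (`effectAut_rankOne`). Hence `φ_T` is monotone, with inverse
`φ_S` for `S = T⁻¹`; effects that are not invertible are handled by a limit (`effectAut_mono`). The
action on rank one effects also determines each `T x` up to a unimodular scalar, which additivity
makes constant.

Conversely, let `φ` be an order automorphism. Rank one effects are the nonzero effects whose lower
sets are chains, and rank one projections are the maximal ones among them, so `φ` permutes the lines
of `H`. Coplanarity of lines is visible in the order, so the fundamental theorem of projective
geometry (here `dim H ≥ 3` enters) yields a semilinear `S` inducing this permutation, and `φ` maps
`rankOne 𝕜 x u` to `rankOne 𝕜 (S x) (G x u)`.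

The function `G` is found by testing on `(I + a ⊗ a*)⁻¹`, whose energy at `x` is `|⟪a, x⟫|²`. The
image has the same form, which gives `G x (|c|²) = k |σ c|²` with one constant `k`. Monotonicity
makes `σ` norm preserving, hence the identity or conjugation, and rescaling `S` by `√k` gives a `T`
that preserves energies. The effect `I / 2`, with energy `‖x‖²`, and uniform boundedness show that
`T` is bounded. Finally `φ` and `φ_T` agree on rank one effects, hence everywhere. -/

section ProjectiveGeometry

/-! ### The fundamental theorem of projective geometry. -/

variable {K V : Type*} [Field K] [AddCommGroup V] [Module K V]

/-- The vector `x'` spans the image of the line through `x` under the map of lines induced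
by `g`. -/
def RepresentsImage (K : Type*) {V : Type*} [Field K] [AddCommGroup V] [Module K V]
    (g : V → V) (x x' : V) : Prop :=
  x ≠ 0 ∧ ∃ c : K, c ≠ 0 ∧ x' = c • g x

/-- `g` maps nonzero vectors to nonzero vectors and preserves and reflects collinearity of the
lines which they span. -/
structure IsCollineation (K : Type*) {V : Type*} [Field K] [AddCommGroup V] [Module K V]
    (g : V → V) : Prop where
  ne_zero : ∀ x, x ≠ 0 → g x ≠ 0
  mem_span_iff : ∀ x y z, x ≠ 0 → y ≠ 0 → z ≠ 0 →
    (z ∈ Submodule.span K {x, y} ↔ g z ∈ Submodule.span K {g x, g y})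
  surj : ∀ y, y ≠ 0 → ∃ x, x ≠ 0 ∧ ∃ c : K, y = c • g x

theorem Submodule.span_pair_smul_smul {a b : K} (ha : a ≠ 0) (hb : b ≠ 0) (x y : V) :
    Submodule.span K {a • x, b • y} = Submodule.span K {x, y} := by
  rw [Submodule.span_insert, Submodule.span_insert,
    Submodule.span_singleton_smul_eq (IsUnit.mk0 a ha),
    Submodule.span_singleton_smul_eq (IsUnit.mk0 b hb)]

namespace IsCollineation

variable {g : V → V}

/-- Spans ignore nonzero scalars, so collinearity can be tested on any representatives of the image
lines; this leaves room to normalize them. -/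
theorem mem_span_pair_iff (hg : IsCollineation K g) {x y z x' y' z' : V}
    (hx : RepresentsImage K g x x') (hy : RepresentsImage K g y y')
    (hz : RepresentsImage K g z z') :
    z ∈ Submodule.span K {x, y} ↔ z' ∈ Submodule.span K {x', y'} := by
  obtain ⟨hx0, a, ha, rfl⟩ := hx
  obtain ⟨hy0, b, hb, rfl⟩ := hy
  obtain ⟨hz0, c, hc, rfl⟩ := hz
  rw [Submodule.span_pair_smul_smul ha hb, Submodule.smul_mem_iff _ hc]
  exact hg.mem_span_iff x y z hx0 hy0 hz0

theorem mem_span_singleton_iff (hg : IsCollineation K g) {x z x' z' : V}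
    (hx : RepresentsImage K g x x') (hz : RepresentsImage K g z z') :
    z ∈ Submodule.span K {x} ↔ z' ∈ Submodule.span K {x'} := by
  simpa using hg.mem_span_pair_iff hx hx hz

theorem represents_ne_zero (hg : IsCollineation K g) {x x' : V}
    (hx : RepresentsImage K g x x') : x' ≠ 0 := by
  obtain ⟨hx0, a, ha, rfl⟩ := hx
  exact smul_ne_zero ha (hg.ne_zero x hx0)

theorem represents_smul (hg : IsCollineation K g) {x x' : V} (hx : RepresentsImage K g x x')
    {c d : K} (hc : c ≠ 0) (hd : d ≠ 0) : RepresentsImage K g (c • x) (d • x') := by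
  have hx' : RepresentsImage K g (c • x) (g (c • x)) :=
    ⟨smul_ne_zero hc hx.1, 1, one_ne_zero, by simp⟩
  have h := (hg.mem_span_singleton_iff hx' hx).1
    (Submodule.mem_span_singleton.2 ⟨c⁻¹, by simp [smul_smul, hc]⟩)
  obtain ⟨m, hm⟩ := Submodule.mem_span_singleton.1 h
  refine ⟨hx'.1, d * m, mul_ne_zero hd ?_, by rw [← hm, smul_smul]⟩
  rintro rfl
  exact hg.represents_ne_zero hx (by simp [← hm])

/-- The images of `e` and of vectors `w` of a hyperplane not containing `e` can be scaled so that
the line of `e + w` is represented by the sum. -/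
theorem exists_normalized (hg : IsCollineation K g) (f : V →ₗ[K] K) {e : V} (he : f e = 1) (w : V)
    (hw : f w = 0) : ∃ s : V, (w = 0 → s = 0) ∧ (w ≠ 0 → RepresentsImage K g w s) ∧
      RepresentsImage K g (e + w) (g e + s) := by
  have he0 : e ≠ 0 := by rintro rfl; simp at he
  by_cases hw0 : w = 0
  · subst hw0
    exact ⟨0, fun _ => rfl, fun h => (h rfl).elim, by simpa using he0, 1, by simp, by simp⟩
  have hew : e + w ≠ 0 := by
    intro h
    have := congrArg f h
    simp [he, hw] at this
  have re : RepresentsImage K g e (g e) := ⟨he0, 1, one_ne_zero, by simp⟩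
  have rw' : RepresentsImage K g w (g w) := ⟨hw0, 1, one_ne_zero, by simp⟩
  have rew : RepresentsImage K g (e + w) (g (e + w)) := ⟨hew, 1, one_ne_zero, by simp⟩
  have h := (hg.mem_span_pair_iff re rw' rew).1
    (Submodule.mem_span_pair.2 ⟨1, 1, by simp⟩)
  obtain ⟨α, β, h⟩ := Submodule.mem_span_pair.1 h
  have hα : α ≠ 0 := by
    rintro rfl
    have h1 := (hg.mem_span_singleton_iff rw' rew).2
      (Submodule.mem_span_singleton.2 ⟨β, by simpa using h⟩)
    obtain ⟨c, hc⟩ := Submodule.mem_span_singleton.1 h1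
    have := congrArg f hc
    simp [he, hw] at this
  have hβ : β ≠ 0 := by
    rintro rfl
    have h1 := (hg.mem_span_singleton_iff re rew).2
      (Submodule.mem_span_singleton.2 ⟨α, by simpa using h⟩)
    obtain ⟨c, hc⟩ := Submodule.mem_span_singleton.1 h1
    have := congrArg f hc
    simp only [map_smul, he, smul_eq_mul, mul_one, map_add, hw, add_zero] at this
    subst this
    simp at hc
    exact hw0 hc
  -- Dividing by `α` makes the coefficient of `g e` equal to one.
  refine ⟨(α⁻¹ * β) • g w, fun h => (hw0 h).elim,
    fun _ => ⟨hw0, _, mul_ne_zero (inv_ne_zero hα) hβ, rfl⟩, hew, α⁻¹, inv_ne_zero hα, ?_⟩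
  rw [← h, smul_add, smul_smul, smul_smul, inv_mul_cancel₀ hα, one_smul]

theorem notMem_span_of_le_rank (hdim : 3 ≤ Module.rank K V) (x y : V) :
    ∃ z, z ∉ Submodule.span K {x, y} := by
  by_contra! h
  have htop : Submodule.span K {x, y} = ⊤ := by ext z; simp [h z]
  have h1 : Module.rank K (Submodule.span K ({x, y} : Set V)) ≤ 2 := by
    classical
    refine (rank_span_le _).trans ?_
    refine (Cardinal.mk_insert_le).trans ?_
    rw [Cardinal.mk_singleton]
    norm_num
  rw [htop, rank_top] at h1
  exact absurd (hdim.trans h1) (by norm_num)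

theorem eq_zero_of_smul_add_smul_eq_zero {b u v : V} (hv : v ≠ 0)
    (huv : u ∉ Submodule.span K {v}) (hb : b ∉ Submodule.span K {u, v}) {α β γ : K}
    (h : α • b + β • u + γ • v = 0) : α = 0 ∧ β = 0 ∧ γ = 0 := by
  have hα : α = 0 := by
    by_contra hα
    refine hb ((Submodule.smul_mem_iff _ hα).1 (Submodule.mem_span_pair.2 ⟨-β, -γ, ?_⟩))
    rw [eq_comm, ← sub_eq_zero, ← h]
    module
  subst hα
  have hβ : β = 0 := by
    by_contra hβ
    refine huv ((Submodule.smul_mem_iff _ hβ).1 (Submodule.mem_span_singleton.2 ⟨-γ, ?_⟩))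
    rw [eq_comm, ← sub_eq_zero, ← h]
    module
  subst hβ
  exact ⟨rfl, rfl, by simpa [hv] using h⟩

/-- A normalized lift of a collineation to a hyperplane is additive on independent pairs. -/
theorem map_add_of_notMem_span (hg : IsCollineation K g) (f : V →ₗ[K] K) {e : V} (he : f e = 1)
    {S : V → V} (hS : ∀ w, f w = 0 → w ≠ 0 → RepresentsImage K g w (S w))
    (hS' : ∀ w, f w = 0 → RepresentsImage K g (e + w) (g e + S w))
    {u v : V} (hu : f u = 0) (hv : f v = 0) (hv0 : v ≠ 0) (huv : u ∉ Submodule.span K {v}) :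
    S (u + v) = S u + S v := by
  have he0 : e ≠ 0 := by rintro rfl; simp at he
  have hu0 : u ≠ 0 := by rintro rfl; simp at huv
  have huv0 : u + v ≠ 0 := by
    intro h
    exact huv (Submodule.mem_span_singleton.2 ⟨-1, by rw [eq_neg_of_add_eq_zero_left h]; simp⟩)
  have re : RepresentsImage K g e (g e) := ⟨he0, 1, one_ne_zero, by simp⟩
  have ru := hS u hu hu0
  have rv := hS v hv hv0
  have ruv := hS (u + v) (by simp [hu, hv]) huv0
  have huv' : S u ∉ Submodule.span K {S v} := fun h => huv ((hg.mem_span_singleton_iff rv ru).2 h)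
  have hb : g e ∉ Submodule.span K {S u, S v} := by
    intro h
    obtain ⟨a, b, hab⟩ := Submodule.mem_span_pair.1 ((hg.mem_span_pair_iff ru rv re).2 h)
    have := congrArg f hab
    simp [hu, hv, he] at this
  obtain ⟨m, n, hmn⟩ := Submodule.mem_span_pair.1 ((hg.mem_span_pair_iff ru rv ruv).1
    (Submodule.mem_span_pair.2 ⟨1, 1, by simp⟩))
  -- The line of `e + (u + v)` lies in the span of `e + u, v` and in that of `e + v, u`. Comparing
  -- coefficients of the independent vectors `g e`, `S u`, `S v` forces `m = n = 1`.
  have reuv := hS' (u + v) (by simp [hu, hv])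
  obtain ⟨p, q, hpq⟩ := Submodule.mem_span_pair.1 ((hg.mem_span_pair_iff (hS' u hu) rv reuv).1
    (Submodule.mem_span_pair.2 ⟨1, 1, by module⟩))
  obtain ⟨r, t, hrt⟩ := Submodule.mem_span_pair.1 ((hg.mem_span_pair_iff (hS' v hv) ru reuv).1
    (Submodule.mem_span_pair.2 ⟨1, 1, by module⟩))
  have hv' := hg.represents_ne_zero rv
  have h1 := eq_zero_of_smul_add_smul_eq_zero (α := 1 - p) (β := m - p) (γ := n - q) hv' huv' hb
    (by rw [← hmn] at hpq; rw [← sub_eq_zero] at hpq; rw [← neg_eq_zero, ← hpq]; module)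
  have h2 := eq_zero_of_smul_add_smul_eq_zero (α := 1 - r) (β := m - t) (γ := n - r) hv' huv' hb
    (by rw [← hmn] at hrt; rw [← sub_eq_zero] at hrt; rw [← neg_eq_zero, ← hrt]; module)
  have hm : m = 1 := by linear_combination h1.2.1 - h1.1
  have hn : n = 1 := by linear_combination h2.2.2 - h2.1
  rw [← hmn, hm, hn, one_smul, one_smul]

theorem exists_hyperplane_notMem_span (hdim : 3 ≤ Module.rank K V) (f : V →ₗ[K] K) {e : V}
    (he : f e = 1) (x : V) : ∃ z, f z = 0 ∧ z ∉ Submodule.span K {x} := by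
  obtain ⟨z, hz⟩ := notMem_span_of_le_rank hdim e x
  refine ⟨z - f z • e, by simp [he], fun h => hz ?_⟩
  obtain ⟨c, hc⟩ := Submodule.mem_span_singleton.1 h
  exact Submodule.mem_span_pair.2 ⟨f z, c, by rw [hc]; module⟩

/-- For proportional `x` and `d • x`, a third vector `z` of the hyperplane off their line reduces
the claim to independent pairs: `z + (x + d • x) = (z + d • x) + x`. -/
theorem map_add_of_hyperplane (hdim : 3 ≤ Module.rank K V) (hg : IsCollineation K g)
    (f : V →ₗ[K] K) {e : V} (he : f e = 1) {S : V → V} (hS0 : S 0 = 0)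
    (hS : ∀ w, f w = 0 → w ≠ 0 → RepresentsImage K g w (S w))
    (hS' : ∀ w, f w = 0 → RepresentsImage K g (e + w) (g e + S w))
    {x y : V} (hx : f x = 0) (hy : f y = 0) : S (x + y) = S x + S y := by
  have key := fun u v hu hv => hg.map_add_of_notMem_span f he hS hS' (u := u) (v := v) hu hv
  by_cases hx0 : x = 0
  · simp [hx0, hS0]
  by_cases hy0 : y = 0
  · simp [hy0, hS0]
  by_cases hxy : y ∈ Submodule.span K {x}
  swap
  · rw [add_comm, key y x hy hx hx0 hxy, add_comm]
  obtain ⟨d, rfl⟩ := Submodule.mem_span_singleton.1 hxy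
  obtain ⟨z, hz, hzx⟩ := exists_hyperplane_notMem_span hdim f he x
  have hz' : ∀ c : K, z ∉ Submodule.span K {c • x} := by
    intro c h
    obtain ⟨a, rfl⟩ := Submodule.mem_span_singleton.1 h
    exact hzx (Submodule.mem_span_singleton.2 ⟨a * c, by rw [smul_smul]⟩)
  have h1 : S (z + (x + d • x)) = S z + S (x + d • x) := by
    by_cases h0 : x + d • x = 0
    · simp [h0, hS0]
    · refine key z _ hz (by simp [hx]) h0 ?_
      have := hz' (1 + d)
      rwa [add_smul, one_smul] at this
  have h2 : S (z + d • x) = S z + S (d • x) := key z _ hz hy hy0 (hz' d)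
  have h3 : S ((z + d • x) + x) = S (z + d • x) + S x := by
    refine key _ _ (by simp [hz, hx]) hx hx0 fun h => hzx ?_
    obtain ⟨a, ha⟩ := Submodule.mem_span_singleton.1 h
    exact Submodule.mem_span_singleton.2 ⟨a - d, by rw [sub_smul, ha]; simp⟩
  have h4 : z + (x + d • x) = (z + d • x) + x := by abel
  rw [h4, h3, h2] at h1
  have : S z + S (x + d • x) = S z + (S x + S (d • x)) := by rw [← h1]; abel
  exact add_left_cancel this

/-- **Fundamental theorem of projective geometry**: a collineation of a space of dimension at
least three is induced by a bijective semilinear map. -/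
theorem exists_semilinear (hdim : 3 ≤ Module.rank K V) (hg : IsCollineation K g) :
    ∃ (σ : K →+* K) (S : V →ₛₗ[σ] V), Function.Bijective σ ∧ Function.Bijective S ∧
      ∀ x, x ≠ 0 → ∃ c : K, c ≠ 0 ∧ S x = c • g x := by
  obtain ⟨e, he0⟩ := notMem_span_of_le_rank hdim (0 : V) 0
  have he0 : e ≠ 0 := by rintro rfl; simp at he0
  obtain ⟨f, he⟩ := Module.Projective.exists_dual_eq_one K he0
  choose! S hS0 hS hS' using fun w => hg.exists_normalized f he w
  have hS0 : S 0 = 0 := hS0 0 (by simp) rfl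
  have hadd : ∀ x y, f x = 0 → f y = 0 → S (x + y) = S x + S y := fun x y hx hy =>
    hg.map_add_of_hyperplane hdim f he hS0 hS hS' hx hy
  have re : RepresentsImage K g e (g e) := ⟨he0, 1, one_ne_zero, by simp⟩
  have hne : ∀ w, f w = 0 → w ≠ 0 → S w ≠ 0 := fun w hw hw0 =>
    hg.represents_ne_zero (hS w hw hw0)
  have hsmul : ∀ (w : V) (c : K), f w = 0 → w ≠ 0 → ∃ d : K, S (c • w) = d • S w := by
    intro w c hw hw0
    by_cases hc : c = 0
    · exact ⟨0, by simp [hc, hS0]⟩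
    have h := (hg.mem_span_singleton_iff (hS w hw hw0)
      (hS (c • w) (by simp [hw]) (smul_ne_zero hc hw0))).1
      (Submodule.mem_span_singleton.2 ⟨c, rfl⟩)
    obtain ⟨d, hd⟩ := Submodule.mem_span_singleton.1 h
    exact ⟨d, hd.symm⟩
  -- Expanding `S (c • (w + z))` in two ways shows that `c` acts on independent vectors of the
  -- hyperplane through the same scalar.
  have hstep : ∀ (z w : V) (c s : K), f z = 0 → z ≠ 0 → f w = 0 → w ∉ Submodule.span K {z} →
      S (c • z) = s • S z → S (c • w) = s • S w := by
    intro z w c s hz hz0 hw hwz h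
    have hw0 : w ≠ 0 := by rintro rfl; simp at hwz
    have hwz0 : w + z ≠ 0 := fun h => hwz
      (Submodule.mem_span_singleton.2 ⟨-1, by rw [eq_neg_of_add_eq_zero_left h]; simp⟩)
    obtain ⟨d, hd⟩ := hsmul w c hw hw0
    obtain ⟨t, ht⟩ := hsmul (w + z) c (by simp [hw, hz]) hwz0
    rw [smul_add, hadd _ _ (by simp [hw]) (by simp [hz]), hadd _ _ hw hz, h, hd] at ht
    have hSwz : S w ∉ Submodule.span K {S z} := fun h =>
      hwz ((hg.mem_span_singleton_iff (hS z hz hz0) (hS w hw hw0)).2 h)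
    have hdt : d = t := by
      by_contra hdt
      refine hSwz ((Submodule.smul_mem_iff _ (sub_ne_zero.2 hdt)).1
        (Submodule.mem_span_singleton.2 ⟨t - s, ?_⟩))
      rw [eq_comm, ← sub_eq_zero] at ht ⊢
      rw [← neg_eq_zero, ← ht]
      module
    subst hdt
    have hst : s = d := by
      have : s • S z = d • S z := by
        rw [smul_add] at ht; exact add_left_cancel ht
      exact smul_left_injective K (hne z hz hz0) this
    rw [hd, hst]
  obtain ⟨w₀, hw₀, hw₀0⟩ := exists_hyperplane_notMem_span hdim f he (0 : V)
  have hw₀0 : w₀ ≠ 0 := by rintro rfl; simp at hw₀0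
  choose σ hσ using fun c : K => hsmul w₀ c hw₀ hw₀0
  have hσS : ∀ (c : K) (w : V), f w = 0 → S (c • w) = σ c • S w := by
    intro c w hw
    by_cases hww : w ∈ Submodule.span K {w₀}
    swap
    · exact hstep w₀ w c (σ c) hw₀ hw₀0 hw hww (hσ c)
    -- On the line of `w₀` itself the scalar is transferred through a vector off that line.
    obtain ⟨z, hz, hzw⟩ := exists_hyperplane_notMem_span hdim f he w₀
    have hz0 : z ≠ 0 := by rintro rfl; simp at hzw
    by_cases hw0 : w = 0
    · simp [hw0, hS0]
    refine hstep z w c (σ c) hz hz0 hw (fun h => ?_)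
      (hstep w₀ z c (σ c) hw₀ hw₀0 hz hzw (hσ c))
    obtain ⟨a, rfl⟩ := Submodule.mem_span_singleton.1 h
    have ha : a ≠ 0 := by rintro rfl; simp at hw0
    exact hzw ((Submodule.smul_mem_iff _ ha).1 hww)
  have hinj := smul_left_injective K (hne w₀ hw₀ hw₀0)
  let σ' : K →+* K :=
    { toFun := σ
      map_one' := hinj (by simp only [← hσ, one_smul])
      map_mul' := fun c d => hinj (by
        simp only
        rw [← hσ, mul_smul, hσS c _ (by simp [hw₀]), hσ, smul_smul])
      map_zero' := hinj (by simp only [← hσ, zero_smul, hS0])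
      map_add' := fun c d => hinj (by
        simp only
        rw [← hσ, add_smul, hadd _ _ (by simp [hw₀]) (by simp [hw₀]), hσ, hσ, add_smul]) }
  have hker : ∀ x, f (x - f x • e) = 0 := fun x => by simp [he]
  -- The semilinear extension of `S` from the kernel of `f` which sends `e` to `g e`.
  let T : V →ₛₗ[σ'] V :=
    { toFun := fun x => σ' (f x) • g e + S (x - f x • e)
      map_add' := fun x y => by
        have : x + y - f (x + y) • e = (x - f x • e) + (y - f y • e) := by
          rw [map_add]; module
        rw [this, hadd _ _ (hker x) (hker y), map_add, map_add]
        module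
      map_smul' := fun c x => by
        have : c • x - f (c • x) • e = c • (x - f x • e) := by
          rw [map_smul, smul_eq_mul]; module
        rw [this, hσS _ _ (hker x), map_smul, smul_eq_mul, map_mul]
        change _ = σ c • _
        change (σ c * _) • _ + _ = _
        module }
  have hT : ∀ x, T x = σ' (f x) • g e + S (x - f x • e) := fun _ => rfl
  have hrep : ∀ x, x ≠ 0 → RepresentsImage K g x (T x) := by
    intro x hx
    by_cases hfx : f x = 0
    · rw [hT, hfx]
      simpa using hS x hfx hx
    -- Off the hyperplane, `x` is `f x` times a vector `e + w` with `f w = 0`, where the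
    -- normalization of `S` applies.
    have h1 := hS' ((f x)⁻¹ • (x - f x • e)) (by simp [he])
    have h2 := hg.represents_smul h1 hfx ((map_ne_zero σ').2 hfx)
    rw [hT]
    convert h2 using 1
    · rw [smul_add, smul_smul, mul_inv_cancel₀ hfx]; module
    · rw [smul_add]
      congr 1
      change _ = σ (f x) • _
      rw [← hσS _ _ (by simp [he]), smul_smul, mul_inv_cancel₀ hfx, one_smul]
  have hTinj : Function.Injective T := by
    rw [injective_iff_map_eq_zero]
    intro x hx
    by_contra hx0
    exact hg.represents_ne_zero (hrep x hx0) hx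
  have hTe : T e = g e := by rw [hT]; simp [he, hS0]
  have hTw : T w₀ = S w₀ := by rw [hT]; simp [hw₀]
  have hexact : ∀ y, y ≠ 0 → ∃ x, ∃ d : K, x ≠ 0 ∧ d ≠ 0 ∧ y = d • T x := by
    intro y hy
    obtain ⟨x, hx0, c, rfl⟩ := hg.surj y hy
    obtain ⟨-, d, hd, h⟩ := hrep x hx0
    refine ⟨x, c * d⁻¹, hx0, mul_ne_zero ?_ (inv_ne_zero hd), ?_⟩
    · rintro rfl; simp at hy
    · rw [h, smul_smul, mul_assoc, inv_mul_cancel₀ hd, mul_one]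
  -- The vector `T e + c • T w₀` spans the image of a line in the span of `e` and `w₀`; the ratio of
  -- the coordinates of that line is a preimage of `c`.
  have hσsurj : Function.Surjective σ' := by
    intro c
    have hind : ∀ p q : K, p • T e + q • T w₀ = 0 → p = 0 ∧ q = 0 := by
      intro p q h
      have hwe : T w₀ ∉ Submodule.span K {T e} := fun h => by
        obtain ⟨a, ha⟩ := Submodule.mem_span_singleton.1
          ((hg.mem_span_singleton_iff (hrep e he0) (hrep w₀ hw₀0)).2 h)
        have := congrArg f ha
        simp only [map_smul, he, smul_eq_mul, mul_one, hw₀] at this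
        subst this
        exact hw₀0 (by simpa using ha.symm)
      have hq : q = 0 := by
        by_contra hq
        refine hwe ((Submodule.smul_mem_iff _ hq).1 (Submodule.mem_span_singleton.2 ⟨-p, ?_⟩))
        rw [eq_comm, ← sub_eq_zero, ← h]
        module
      subst hq
      have hTe0 : T e ≠ 0 := hg.represents_ne_zero (hrep e he0)
      exact ⟨by simpa [hTe0] using h, rfl⟩
    have hy : T e + c • T w₀ ≠ 0 := fun h => one_ne_zero (hind 1 c (by simpa using h)).1
    obtain ⟨x, d, hx0, hd, hxd⟩ := hexact _ hy
    have hmem : T x ∈ Submodule.span K {T e, T w₀} := by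
      refine (Submodule.smul_mem_iff _ hd).1 (Submodule.mem_span_pair.2 ⟨1, c, ?_⟩)
      rw [← hxd, one_smul]
    obtain ⟨α, β, rfl⟩ := Submodule.mem_span_pair.1
      ((hg.mem_span_pair_iff (hrep e he0) (hrep w₀ hw₀0) (hrep x hx0)).2 hmem)
    rw [map_add, LinearMap.map_smulₛₗ, LinearMap.map_smulₛₗ, ← sub_eq_zero] at hxd
    obtain ⟨h1, h2⟩ := hind (1 - d * σ' α) (c - d * σ' β) (by rw [← hxd]; module)
    have hα : σ' α ≠ 0 := by intro h; simp [h] at h1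
    refine ⟨β / α, ?_⟩
    rw [map_div₀, div_eq_iff hα]
    have hd' : d * (σ' β - c * σ' α) = 0 := by linear_combination c * h1 - h2
    linear_combination (mul_eq_zero.1 hd').resolve_left hd
  refine ⟨σ', T, ⟨σ'.injective, hσsurj⟩, ⟨hTinj, fun y => ?_⟩, fun x hx => (hrep x hx).2⟩
  by_cases hy : y = 0
  · exact ⟨0, by simp [hy]⟩
  obtain ⟨x, d, -, -, rfl⟩ := hexact y hy
  obtain ⟨c, rfl⟩ := hσsurj d
  exact ⟨c • x, by simp⟩

end IsCollineation

end ProjectiveGeometry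

/-! ### Forms of positive operators and of rank one operators. -/

section PositiveOperators

variable {𝕜 H : Type*} [RCLike 𝕜] [NormedAddCommGroup H] [InnerProductSpace 𝕜 H]

namespace ContinuousLinearMap.IsPositive

/-- Cauchy–Schwarz inequality for the form of a positive operator. -/
theorem norm_inner_sq_le {A : H →L[𝕜] H} (hA : A.IsPositive) (x y : H) :
    ‖⟪A x, y⟫_𝕜‖ ^ 2 ≤ RCLike.re ⟪A x, x⟫_𝕜 * RCLike.re ⟪A y, y⟫_𝕜 := by
  let c : PreInnerProductSpace.Core 𝕜 H :=
    { inner := fun x y => ⟪A x, y⟫_𝕜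
      conj_inner_symm := fun x y => by
        simp only [inner_conj_symm]
        exact (hA.inner_left_eq_inner_right x y).symm
      re_inner_nonneg := fun x => hA.re_inner_nonneg_left x
      add_left := fun x y z => by simp [inner_add_left]
      smul_left := fun x y r => by simp [inner_smul_left] }
  have h := @InnerProductSpace.Core.inner_mul_inner_self_le 𝕜 H _ _ _ c x y
  have h2 : ‖⟪A y, x⟫_𝕜‖ = ‖⟪A x, y⟫_𝕜‖ := by
    rw [hA.inner_left_eq_inner_right y x, norm_inner_symm]
  change ‖⟪A x, y⟫_𝕜‖ * ‖⟪A y, x⟫_𝕜‖ ≤ _ at h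
  rw [h2, ← sq] at h
  exact h

theorem apply_eq_zero {A : H →L[𝕜] H} (hA : A.IsPositive) {x : H}
    (hx : RCLike.re ⟪A x, x⟫_𝕜 ≤ 0) : A x = 0 := by
  have h := hA.norm_inner_sq_le x (A x)
  have h2 : ‖⟪A x, A x⟫_𝕜‖ ^ 2 ≤ 0 := h.trans
    (mul_nonpos_of_nonpos_of_nonneg hx (hA.re_inner_nonneg_left (A x)))
  have h3 : ⟪A x, A x⟫_𝕜 = 0 := by
    rw [← norm_eq_zero]
    exact pow_eq_zero_iff two_ne_zero |>.1 (le_antisymm h2 (sq_nonneg _))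
  exact inner_self_eq_zero.1 h3

end ContinuousLinearMap.IsPositive

theorem re_inner_le_of_le {A B : H →L[𝕜] H} (h : A ≤ B) (x : H) :
    RCLike.re ⟪A x, x⟫_𝕜 ≤ RCLike.re ⟪B x, x⟫_𝕜 := by
  have := ((ContinuousLinearMap.le_def A B).1 h).re_inner_nonneg_left x
  simpa [inner_sub_left] using this

theorem le_of_re_inner_le {A B : H →L[𝕜] H} (hA : A.IsPositive) (hB : B.IsPositive)
    (h : ∀ x, RCLike.re ⟪A x, x⟫_𝕜 ≤ RCLike.re ⟪B x, x⟫_𝕜) : A ≤ B := by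
  refine (ContinuousLinearMap.le_def A B).2 ⟨hB.isSymmetric.sub hA.isSymmetric, fun x => ?_⟩
  have := h x
  simpa [ContinuousLinearMap.reApplyInnerSelf, inner_sub_left] using this

/-- A symmetric operator which vanishes on the orthogonal complement of `x` is a multiple of the
rank one operator of `x`. -/
theorem eq_smul_rankOne_of_apply_eq_zero {A : H →L[𝕜] H}
    (hA : (A : H →ₗ[𝕜] H).IsSymmetric) {x : H} (hx : x ≠ 0)
    (h : ∀ v, ⟪x, v⟫_𝕜 = 0 → A v = 0) :
    A = ((RCLike.re ⟪A x, x⟫_𝕜 / ‖x‖ ^ 4 : ℝ) : 𝕜) • InnerProductSpace.rankOne 𝕜 x x := by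
  have hx' : (‖x‖ : 𝕜) ≠ 0 := by simpa using hx
  have hA' : ∀ v w, ⟪A v, w⟫_𝕜 = ⟪v, A w⟫_𝕜 := hA
  have h1 : ∀ v, A v = (⟪x, v⟫_𝕜 / (‖x‖ : 𝕜) ^ 2) • A x := by
    intro v
    have := h (v - (⟪x, v⟫_𝕜 / (‖x‖ : 𝕜) ^ 2) • x) (by
      rw [inner_sub_right, inner_smul_right, inner_self_eq_norm_sq_to_K]
      field_simp
      simp)
    rwa [map_sub, map_smul, sub_eq_zero] at this
  have h2 : ⟪x, A x⟫_𝕜 = (RCLike.re ⟪A x, x⟫_𝕜 : 𝕜) := by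
    have h3 : (starRingEnd 𝕜) ⟪A x, x⟫_𝕜 = ⟪A x, x⟫_𝕜 := by
      rw [inner_conj_symm]; exact (hA' x x).symm
    rw [← hA']
    exact (RCLike.conj_eq_iff_re.1 h3).symm
  ext v
  refine ext_inner_left 𝕜 fun w => ?_
  rw [h1, inner_smul_right, ← hA', h1 w, inner_smul_left, hA', h2]
  simp only [smul_apply, InnerProductSpace.rankOne_apply,
    inner_smul_right, map_div₀, inner_conj_symm, map_pow, RCLike.conj_ofReal]
  push_cast
  field_simp

theorem apply_eq_zero_of_range_subset_span {A : H →L[𝕜] H}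
    (hA : (A : H →ₗ[𝕜] H).IsSymmetric) {x : H} (h : ∀ v, A v ∈ Submodule.span 𝕜 {x}) (v : H)
    (hv : ⟪x, v⟫_𝕜 = 0) : A v = 0 := by
  have hA' : ∀ v w, ⟪A v, w⟫_𝕜 = ⟪v, A w⟫_𝕜 := hA
  obtain ⟨c, hc⟩ := Submodule.mem_span_singleton.1 (h (A v))
  have : ⟪A v, A v⟫_𝕜 = 0 := by
    rw [hA', ← hc, inner_smul_right, inner_eq_zero_symm.1 hv, mul_zero]
  exact inner_self_eq_zero.1 this

theorem re_inner_smul_rankOne (r : ℝ) (x v : H) :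
    RCLike.re ⟪((r : 𝕜) • InnerProductSpace.rankOne 𝕜 x x) v, v⟫_𝕜 = r * ‖⟪x, v⟫_𝕜‖ ^ 2 := by
  simp only [smul_apply, InnerProductSpace.rankOne_apply, inner_smul_left, RCLike.conj_ofReal]
  rw [RCLike.conj_mul, ← RCLike.ofReal_pow, ← RCLike.ofReal_mul, RCLike.ofReal_re]

theorem isPositive_smul_rankOne {r : ℝ} (hr : 0 ≤ r) (x : H) :
    ((r : 𝕜) • InnerProductSpace.rankOne 𝕜 x x).IsPositive :=
  (InnerProductSpace.isPositive_rankOne_self x).smul_of_nonneg (by exact_mod_cast hr)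

end PositiveOperators

/-! ### Rank one effects and the order they determine. -/

section Effects

variable {𝕜 H : Type*} [RCLike 𝕜] [NormedAddCommGroup H] [InnerProductSpace 𝕜 H]

theorem mem_effects_iff {A : H →L[𝕜] H} :
    A ∈ effects 𝕜 H ↔ A.IsPositive ∧ (1 - A).IsPositive := by
  rw [Set.mem_Icc, ContinuousLinearMap.nonneg_iff_isPositive, ContinuousLinearMap.le_def]

namespace effects

theorem isPositive (A : effects 𝕜 H) : (A : H →L[𝕜] H).IsPositive :=
  (mem_effects_iff.1 A.2).1

theorem isPositive_one_sub (A : effects 𝕜 H) : (1 - (A : H →L[𝕜] H)).IsPositive :=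
  (mem_effects_iff.1 A.2).2

theorem inner_apply (A : effects 𝕜 H) (x y : H) : ⟪A.1 x, y⟫_𝕜 = ⟪x, A.1 y⟫_𝕜 :=
  (isPositive A).inner_left_eq_inner_right x y

theorem le_iff {A B : effects 𝕜 H} :
    A ≤ B ↔ ∀ x, RCLike.re ⟪A.1 x, x⟫_𝕜 ≤ RCLike.re ⟪B.1 x, x⟫_𝕜 :=
  ⟨fun h x => re_inner_le_of_le h x, fun h => le_of_re_inner_le (isPositive A) (isPositive B) h⟩

theorem re_inner_apply_le (A : effects 𝕜 H) (x : H) : RCLike.re ⟪A.1 x, x⟫_𝕜 ≤ ‖x‖ ^ 2 := by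
  have := re_inner_le_of_le A.2.2 x
  rwa [one_apply_eq_self, inner_self_eq_norm_sq] at this

/-- This is `A² ≤ A`, that is, nonnegativity of energies: Cauchy–Schwarz for the form of `A` at `x`
and `A x`, combined with `A ≤ I` at `A x`. -/
theorem norm_apply_sq_le (A : effects 𝕜 H) (x : H) :
    ‖A.1 x‖ ^ 2 ≤ RCLike.re ⟪A.1 x, x⟫_𝕜 := by
  by_cases h0 : A.1 x = 0
  · simp [h0]
  have h := (isPositive A).norm_inner_sq_le x (A.1 x)
  have h2 := (re_inner_apply_le A) (A.1 x)
  rw [inner_self_eq_norm_sq_to_K, ← RCLike.ofReal_pow, RCLike.norm_ofReal,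
    abs_of_nonneg (by positivity)] at h
  have h3 : 0 < ‖A.1 x‖ ^ 2 := by positivity
  have h4 := (isPositive A).re_inner_nonneg_left x
  have h5 := mul_le_mul_of_nonneg_left h2 h4
  exact le_of_mul_le_mul_right (by nlinarith) h3

/-- The rank one effect whose energy (the value of the form of `X⁻¹ - I`) at `x` is `u`. -/
noncomputable def rankOne (𝕜 : Type*) {H : Type*} [RCLike 𝕜] [NormedAddCommGroup H]
    [InnerProductSpace 𝕜 H] (x : H) (u : NNReal) : effects 𝕜 H :=
  ⟨(((‖x‖ ^ 2 + u)⁻¹ : ℝ) : 𝕜) • InnerProductSpace.rankOne 𝕜 x x, by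
    have hp : 0 ≤ (‖x‖ ^ 2 + u)⁻¹ := by positivity
    refine ⟨?_, ?_⟩
    · rw [ContinuousLinearMap.nonneg_iff_isPositive]
      exact isPositive_smul_rankOne hp x
    · refine le_of_re_inner_le (isPositive_smul_rankOne hp x)
        ContinuousLinearMap.isPositive_one fun v => ?_
      rw [re_inner_smul_rankOne, one_apply_eq_self, inner_self_eq_norm_sq]
      have h1 := norm_inner_le_norm (𝕜 := 𝕜) x v
      have h2 : ‖⟪x, v⟫_𝕜‖ ^ 2 ≤ (‖x‖ ^ 2 + u) * ‖v‖ ^ 2 := by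
        have : ‖⟪x, v⟫_𝕜‖ ^ 2 ≤ (‖x‖ * ‖v‖) ^ 2 := by gcongr
        have hu : 0 ≤ (u : ℝ) * ‖v‖ ^ 2 := by positivity
        nlinarith
      by_cases hx : ‖x‖ ^ 2 + u = 0
      · rw [hx]; simp
      · rw [inv_mul_le_iff₀ (lt_of_le_of_ne (by positivity) (Ne.symm hx))]
        exact h2⟩

theorem rankOne_coe (x : H) (u : NNReal) : (rankOne 𝕜 x u : H →L[𝕜] H) =
    (((‖x‖ ^ 2 + u)⁻¹ : ℝ) : 𝕜) • InnerProductSpace.rankOne 𝕜 x x := rfl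

theorem rankOne_apply (x : H) (u : NNReal) (v : H) :
    (rankOne 𝕜 x u).1 v = ((((‖x‖ ^ 2 + u)⁻¹ : ℝ) : 𝕜) * ⟪x, v⟫_𝕜) • x := by
  rw [rankOne_coe, smul_apply, InnerProductSpace.rankOne_apply, smul_smul]

theorem re_inner_rankOne (x : H) (u : NNReal) (v : H) :
    RCLike.re ⟪(rankOne 𝕜 x u).1 v, v⟫_𝕜 = (‖x‖ ^ 2 + u)⁻¹ * ‖⟪x, v⟫_𝕜‖ ^ 2 :=
  re_inner_smul_rankOne _ _ _

theorem normSq_add_pos {x : H} (hx : x ≠ 0) (u : NNReal) : 0 < ‖x‖ ^ 2 + (u : ℝ) := by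
  positivity

theorem rankOne_le_iff {x : H} (hx : x ≠ 0) {u : NNReal} {A : effects 𝕜 H} :
    rankOne 𝕜 x u ≤ A ↔
      ∀ v, ‖⟪x, v⟫_𝕜‖ ^ 2 ≤ (‖x‖ ^ 2 + u) * RCLike.re ⟪A.1 v, v⟫_𝕜 := by
  rw [le_iff]
  refine forall_congr' fun v => ?_
  rw [re_inner_rankOne, inv_mul_le_iff₀ (normSq_add_pos hx u)]

/-- At `A v` the form of `A⁻¹` takes the value `⟪A v, v⟫`, so energies on the range make sense
without inverting `A`. The bound is Cauchy–Schwarz for the form of `A`, sharp at `v`. -/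
theorem rankOne_apply_le_iff {A : effects 𝕜 H} {v : H} (hv : A.1 v ≠ 0) {u : NNReal} :
    rankOne 𝕜 (A.1 v) u ≤ A ↔ RCLike.re ⟪A.1 v, v⟫_𝕜 ≤ ‖A.1 v‖ ^ 2 + u := by
  rw [rankOne_le_iff hv]
  refine ⟨fun h => ?_, fun h w => ?_⟩
  · have h1 := h v
    have h2 : RCLike.re ⟪A.1 v, v⟫_𝕜 ≤ ‖⟪A.1 v, v⟫_𝕜‖ := RCLike.re_le_norm _
    have h3 : 0 < RCLike.re ⟪A.1 v, v⟫_𝕜 := by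
      by_contra h3
      exact hv ((isPositive A).apply_eq_zero (not_lt.1 h3))
    nlinarith
  · exact ((isPositive A).norm_inner_sq_le v w).trans
      (mul_le_mul_of_nonneg_right h ((isPositive A).re_inner_nonneg_left w))

theorem exists_rankOne_apply_le (A : effects 𝕜 H) (v : H) (hv : A.1 v ≠ 0) :
    ∃ u : NNReal, rankOne 𝕜 (A.1 v) u ≤ A ∧
      ‖A.1 v‖ ^ 2 + (u : ℝ) = RCLike.re ⟪A.1 v, v⟫_𝕜 := by
  obtain ⟨u, hu⟩ : ∃ u : NNReal, (u : ℝ) = RCLike.re ⟪A.1 v, v⟫_𝕜 - ‖A.1 v‖ ^ 2 :=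
    ⟨⟨_, sub_nonneg.2 (norm_apply_sq_le A v)⟩, rfl⟩
  refine ⟨u, (rankOne_apply_le_iff hv).2 ?_, ?_⟩
  · rw [hu]; linarith
  · rw [hu]; ring

/-- An effect is the supremum of the rank one effects below it. -/
theorem le_of_forall_rankOne_le {A B : effects 𝕜 H}
    (h : ∀ v u, A.1 v ≠ 0 → rankOne 𝕜 (A.1 v) u ≤ A → rankOne 𝕜 (A.1 v) u ≤ B) : A ≤ B := by
  rw [le_iff]
  intro v
  by_cases hv : A.1 v = 0
  · rw [hv]; simpa using (isPositive B).re_inner_nonneg_left v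
  obtain ⟨u, hu, hu'⟩ := (exists_rankOne_apply_le A) v hv
  have h1 := (rankOne_le_iff hv).1 (h _ u hv hu) v
  have h2 : RCLike.re ⟪A.1 v, v⟫_𝕜 ≤ ‖⟪A.1 v, v⟫_𝕜‖ := RCLike.re_le_norm _
  rw [hu'] at h1
  have h3 : 0 < RCLike.re ⟪A.1 v, v⟫_𝕜 := by rw [← hu']; exact normSq_add_pos hv u
  nlinarith

theorem rankOne_smul {c : 𝕜} (hc : c ≠ 0) (x : H) (u : NNReal) :
    rankOne 𝕜 (c • x) (‖c‖₊ ^ 2 * u) = rankOne 𝕜 x u := by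
  apply Subtype.ext
  ext v
  have hc' : (‖c‖ : 𝕜) ≠ 0 := by simpa using hc
  have h : ‖c • x‖ ^ 2 + ((‖c‖₊ ^ 2 * u : NNReal) : ℝ) = ‖c‖ ^ 2 * (‖x‖ ^ 2 + u) := by
    rw [norm_smul]; push_cast; ring
  rw [rankOne_apply, rankOne_apply, smul_smul, inner_smul_left, h]
  congr 1
  have h2 : (starRingEnd 𝕜) c * c = (‖c‖ : 𝕜) ^ 2 := RCLike.conj_mul c
  rw [mul_inv, RCLike.ofReal_mul]
  calc _ = (((‖c‖ ^ 2)⁻¹ : ℝ) : 𝕜) * ((starRingEnd 𝕜) c * c) *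
        ((((‖x‖ ^ 2 + u)⁻¹ : ℝ) : 𝕜) * ⟪x, v⟫_𝕜) := by ring
    _ = _ := by
      rw [h2, RCLike.ofReal_inv, RCLike.ofReal_pow, inv_mul_cancel₀ (pow_ne_zero 2 hc'), one_mul]

theorem rankOne_le_rankOne_iff {x : H} (hx : x ≠ 0) {u w : NNReal} :
    rankOne 𝕜 x u ≤ rankOne 𝕜 x w ↔ w ≤ u := by
  rw [rankOne_le_iff hx]
  have hw := normSq_add_pos hx w
  constructor
  · intro h
    have h1 := h x
    rw [re_inner_rankOne, ← mul_assoc, ← div_eq_mul_inv] at h1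
    have h2 : 0 < ‖⟪x, x⟫_𝕜‖ ^ 2 := by
      have : ⟪x, x⟫_𝕜 ≠ 0 := inner_self_ne_zero.2 hx
      positivity
    have h3 : 1 ≤ (‖x‖ ^ 2 + u) / (‖x‖ ^ 2 + w) := le_of_mul_le_mul_right (by linarith) h2
    rw [le_div_iff₀ hw] at h3
    exact_mod_cast (by linarith : (w : ℝ) ≤ u)
  · intro h v
    rw [re_inner_rankOne, ← mul_assoc, ← div_eq_mul_inv]
    have h3 : 1 ≤ (‖x‖ ^ 2 + (u : ℝ)) / (‖x‖ ^ 2 + w) := by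
      rw [le_div_iff₀ hw]
      have : (w : ℝ) ≤ u := by exact_mod_cast h
      linarith
    nlinarith [sq_nonneg ‖⟪x, v⟫_𝕜‖]

theorem mem_span_of_rankOne_le {x y : H} (hx : x ≠ 0) {u w : NNReal}
    (h : rankOne 𝕜 x u ≤ rankOne 𝕜 y w) : x ∈ Submodule.span 𝕜 {y} := by
  rw [rankOne_le_iff hx] at h
  by_cases hy : y = 0
  · have := h x
    rw [re_inner_rankOne, hy] at this
    simp at this
    exact (hx this).elim
  have hy' : (‖y‖ : 𝕜) ≠ 0 := by simpa using hy
  -- The component of `x` orthogonal to `y`, on which the larger form vanishes.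
  set v := x - (⟪y, x⟫_𝕜 / (‖y‖ : 𝕜) ^ 2) • y with hv
  have hyv : ⟪y, v⟫_𝕜 = 0 := by
    rw [hv, inner_sub_right, inner_smul_right, inner_self_eq_norm_sq_to_K]
    field_simp
    simp
  have h1 := h v
  rw [re_inner_rankOne, hyv] at h1
  have h2 : ⟪x, v⟫_𝕜 = 0 := by
    rw [← norm_eq_zero]
    exact pow_eq_zero_iff two_ne_zero |>.1 (le_antisymm (by simpa using h1) (sq_nonneg _))
  have h3 : ⟪v, v⟫_𝕜 = 0 := by
    conv_lhs => arg 2; rw [hv]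
    rw [inner_sub_left, inner_smul_left, hyv, h2]; simp
  have h4 : v = 0 := inner_self_eq_zero.1 h3
  rw [hv, sub_eq_zero] at h4
  exact Submodule.mem_span_singleton.2 ⟨_, h4.symm⟩

theorem rankOne_ne_zero {x : H} (hx : x ≠ 0) (u : NNReal) : (rankOne 𝕜 x u).1 ≠ 0 := by
  intro h
  have h1 := re_inner_rankOne (𝕜 := 𝕜) x u x
  rw [h] at h1
  have h2 : ⟪x, x⟫_𝕜 ≠ 0 := inner_self_ne_zero.2 hx
  have h3 : 0 < (‖x‖ ^ 2 + (u : ℝ))⁻¹ * ‖⟪x, x⟫_𝕜‖ ^ 2 :=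
    mul_pos (inv_pos.2 (normSq_add_pos hx u)) (by positivity)
  simp only [zero_apply, inner_zero_left, map_zero] at h1
  linarith

/-- An effect below a rank one effect vanishes on the orthogonal complement of `x`, hence is a real
multiple of `x ⊗ x*`. -/
theorem le_total_of_le_rankOne {x : H} (hx : x ≠ 0) {u : NNReal} {Y Z : effects 𝕜 H}
    (hY : Y ≤ rankOne 𝕜 x u) (hZ : Z ≤ rankOne 𝕜 x u) : Y ≤ Z ∨ Z ≤ Y := by
  have key : ∀ Y : effects 𝕜 H, Y ≤ rankOne 𝕜 x u →
      ∃ r : ℝ, Y.1 = (r : 𝕜) • InnerProductSpace.rankOne 𝕜 x x := by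
    intro Y hY
    refine ⟨_, eq_smul_rankOne_of_apply_eq_zero (isPositive Y).isSymmetric hx fun v hv => ?_⟩
    refine (isPositive Y).apply_eq_zero ((le_iff.1 hY v).trans ?_)
    rw [re_inner_rankOne, hv]; simp
  obtain ⟨r, hr⟩ := key Y hY
  obtain ⟨s, hs⟩ := key Z hZ
  rcases le_total r s with h | h
  · refine Or.inl (le_iff.2 fun v => ?_)
    rw [hr, hs, re_inner_smul_rankOne, re_inner_smul_rankOne]
    gcongr
  · refine Or.inr (le_iff.2 fun v => ?_)
    rw [hr, hs, re_inner_smul_rankOne, re_inner_smul_rankOne]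
    gcongr

/-- A nonzero effect is of rank one if the effects below it are totally ordered. -/
theorem exists_eq_rankOne {A : effects 𝕜 H} (hA : A.1 ≠ 0)
    (h : ∀ Y Z : effects 𝕜 H, Y ≤ A → Z ≤ A → Y ≤ Z ∨ Z ≤ Y) :
    ∃ x u, x ≠ 0 ∧ A = rankOne 𝕜 x u := by
  obtain ⟨v, hv⟩ : ∃ v, A.1 v ≠ 0 := by
    by_contra! h0
    exact hA (by ext v; simp [h0 v])
  -- The rank one effects below `A` along `A v` and `A w` are comparable, so their lines coincide.
  have hspan : ∀ w, A.1 w ∈ Submodule.span 𝕜 {A.1 v} := by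
    intro w
    by_cases hw : A.1 w = 0
    · rw [hw]; exact Submodule.zero_mem _
    obtain ⟨u, hu, -⟩ := (exists_rankOne_apply_le A) v hv
    obtain ⟨u', hu', -⟩ := (exists_rankOne_apply_le A) w hw
    rcases h _ _ hu hu' with h1 | h1
    · obtain ⟨c, hc⟩ := Submodule.mem_span_singleton.1 (mem_span_of_rankOne_le hv h1)
      have hc0 : c ≠ 0 := by rintro rfl; exact hv (by simpa using hc.symm)
      exact Submodule.mem_span_singleton.2
        ⟨c⁻¹, by rw [← hc, smul_smul, inv_mul_cancel₀ hc0, one_smul]⟩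
    · exact mem_span_of_rankOne_le hw h1
  set x := A.1 v with hx
  have hAx := eq_smul_rankOne_of_apply_eq_zero (isPositive A).isSymmetric hv
    (apply_eq_zero_of_range_subset_span (isPositive A).isSymmetric hspan)
  set s : ℝ := RCLike.re ⟪A.1 x, x⟫_𝕜 / ‖x‖ ^ 4 with hs
  have hx0 : 0 < ‖x‖ := norm_pos_iff.2 hv
  have hs0 : 0 ≤ s := div_nonneg ((isPositive A).re_inner_nonneg_left x) (by positivity)
  have hs1 : 0 < s := by
    refine lt_of_le_of_ne hs0 fun h0 => hA ?_
    rw [hAx, ← h0]; simp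
  have hle : ‖x‖ ^ 2 ≤ s⁻¹ := by
    have h1 := (re_inner_apply_le A) x
    have h2 : RCLike.re ⟪A.1 x, x⟫_𝕜 = s * ‖x‖ ^ 4 := by rw [hs]; field_simp
    rw [h2] at h1
    rw [← one_div, le_div_iff₀ hs1]
    have h3 : 0 < ‖x‖ ^ 2 := by positivity
    nlinarith
  obtain ⟨u, hu⟩ : ∃ u : NNReal, (u : ℝ) = s⁻¹ - ‖x‖ ^ 2 := ⟨⟨_, sub_nonneg.2 hle⟩, rfl⟩
  refine ⟨x, u, hv, Subtype.ext ?_⟩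
  rw [rankOne_coe, hu, add_sub_cancel, inv_inv]
  exact hAx

/-- At `u = 0` the rank one effect is the projection onto the line of `x`; dominating it makes the
form of `I - A` vanish at `x`. -/
theorem rankOne_zero_le_iff {x : H} (hx : x ≠ 0) {A : effects 𝕜 H} :
    rankOne 𝕜 x 0 ≤ A ↔ A.1 x = x := by
  constructor
  · intro h
    have h1 := (rankOne_le_iff hx).1 h x
    have h2 : (1 - A.1) x = 0 := by
      refine (isPositive_one_sub A).apply_eq_zero ?_
      rw [sub_apply, inner_sub_left, one_apply_eq_self, map_sub, inner_self_eq_norm_sq]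
      rw [inner_self_eq_norm_sq_to_K, ← RCLike.ofReal_pow, RCLike.norm_ofReal,
        abs_of_nonneg (by positivity)] at h1
      have h3 : 0 < ‖x‖ ^ 2 := by positivity
      simp only [NNReal.coe_zero, add_zero] at h1
      nlinarith
    rw [sub_apply, one_apply_eq_self, sub_eq_zero] at h2
    exact h2.symm
  · intro h
    have := (rankOne_apply_le_iff (A := A) (v := x) (by rwa [h]) (u := 0)).2
    rw [h] at this
    exact this (by rw [inner_self_eq_norm_sq]; simp)

end effects

end Effects

/-! ### Adjoints and inverses of semilinear operators. -/

section SemilinearMaps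

variable {𝕜 H : Type*} [RCLike 𝕜] [NormedAddCommGroup H] [InnerProductSpace 𝕜 H]

theorem IsIdOrConj.re_apply (σ : 𝕜 →+* 𝕜) [h : IsIdOrConj σ] (c : 𝕜) :
    RCLike.re (σ c) = RCLike.re c := by
  rcases h.eq_id_or_conj with h | h <;> simp [h]

theorem IsIdOrConj.apply_ofReal (σ : 𝕜 →+* 𝕜) [h : IsIdOrConj σ] (r : ℝ) :
    σ (r : 𝕜) = r := by
  rcases h.eq_id_or_conj with h | h <;> simp [h]

theorem ContinuousLinearMap.exists_pos_norm_le [CompleteSpace H] {σ : 𝕜 →+* 𝕜} [IsIdOrConj σ]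
    (T : H →SL[σ] H) (hT : Function.Bijective T) : ∃ c : ℝ, 0 < c ∧ ∀ x, c * ‖x‖ ≤ ‖T x‖ := by
  obtain ⟨-, c, hc⟩ := (ContinuousLinearMap.bijective_iff_dense_range_and_antilipschitz T).1 hT
  have h1 := ContinuousLinearMap.bound_of_antilipschitz T hc
  refine ⟨((c : ℝ) + 1)⁻¹, by positivity, fun x => ?_⟩
  rw [inv_mul_le_iff₀ (by positivity)]
  nlinarith [h1 x, norm_nonneg (T x)]

theorem inner_semiAdjoint_left [CompleteSpace H] {σ : 𝕜 →+* 𝕜} [IsIdOrConj σ] (T : H →SL[σ] H)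
    (x y : H) : ⟪semiAdjoint T y, x⟫_𝕜 = σ ⟪y, T x⟫_𝕜 :=
  inner_toDual_semiFunctional T x y

theorem inner_semiAdjoint_right [CompleteSpace H] {σ : 𝕜 →+* 𝕜} [IsIdOrConj σ] (T : H →SL[σ] H)
    (x y : H) : ⟪x, semiAdjoint T y⟫_𝕜 = σ ⟪T x, y⟫_𝕜 := by
  rw [inner_semiAdjoint, IsIdOrConj.apply_apply]

theorem semiAdjoint_injective [CompleteSpace H] {σ : 𝕜 →+* 𝕜} [IsIdOrConj σ] {T : H →SL[σ] H}
    (hT : Function.Surjective T) : Function.Injective (semiAdjoint T) := by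
  rw [injective_iff_map_eq_zero]
  intro y hy
  obtain ⟨x, rfl⟩ := hT y
  have := inner_semiAdjoint T x (T x)
  rw [hy, inner_zero_right, map_zero] at this
  exact inner_self_eq_zero.1 this

theorem semiAdjoint_leftInverse [CompleteSpace H] {σ : 𝕜 →+* 𝕜} [IsIdOrConj σ]
    {T S : H →SL[σ] H} (h : ∀ x, S (T x) = x) (y : H) :
    semiAdjoint T (semiAdjoint S y) = y := by
  refine ext_inner_left 𝕜 fun x => ?_
  rw [inner_semiAdjoint_right, inner_semiAdjoint_right, h, IsIdOrConj.apply_apply]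

theorem exists_rightInverse_semilinear [CompleteSpace H] {σ : 𝕜 →+* 𝕜} [IsIdOrConj σ]
    {T : H →SL[σ] H} (hT : Function.Bijective T) :
    ∃ S : H →SL[σ] H, (∀ x, S (T x) = x) ∧ ∀ x, T (S x) = x := by
  let e := ContinuousLinearEquiv.ofBijective T (LinearMap.ker_eq_bot.2 hT.1)
    (LinearMap.range_eq_top.2 hT.2)
  exact ⟨(e.symm : H →SL[σ] H), fun x => e.symm_apply_apply x, fun x => e.apply_symm_apply x⟩

end SemilinearMaps

/-! ### Approximation of an effect from above by invertible effects. -/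

section TowardsOne

variable {𝕜 H : Type*} [RCLike 𝕜] [NormedAddCommGroup H] [InnerProductSpace 𝕜 H]

/-- The effect `Y + ε (I - Y)`. -/
noncomputable def effects.towardsOne (Y : effects 𝕜 H) (ε : ℝ) (hε : ε ∈ Set.Icc (0 : ℝ) 1) :
    effects 𝕜 H :=
  ⟨Y.1 + (ε : 𝕜) • (1 - Y.1), by
    rw [mem_effects_iff]
    have h1 : 1 - (Y.1 + (ε : 𝕜) • (1 - Y.1)) = ((1 - ε : ℝ) : 𝕜) • (1 - Y.1) := by
      push_cast; module
    rw [h1]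
    exact ⟨(effects.isPositive Y).add ((effects.isPositive_one_sub Y).smul_of_nonneg
      (by exact_mod_cast hε.1)), (effects.isPositive_one_sub Y).smul_of_nonneg
      (by exact_mod_cast sub_nonneg.2 hε.2)⟩⟩

theorem effects.re_inner_towardsOne (Y : effects 𝕜 H) (ε : ℝ) (hε : ε ∈ Set.Icc (0 : ℝ) 1) (x : H) :
    RCLike.re ⟪(effects.towardsOne Y ε hε).1 x, x⟫_𝕜 =
      RCLike.re ⟪Y.1 x, x⟫_𝕜 + ε * (‖x‖ ^ 2 - RCLike.re ⟪Y.1 x, x⟫_𝕜) := by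
  change RCLike.re ⟪(Y.1 + (ε : 𝕜) • (1 - Y.1)) x, x⟫_𝕜 = _
  rw [add_apply, smul_apply, sub_apply, inner_add_left, inner_smul_left, inner_sub_left,
    one_apply_eq_self, RCLike.conj_ofReal, map_add, RCLike.re_ofReal_mul, map_sub,
    inner_self_eq_norm_sq]

end TowardsOne

/-! ### The maps `φ_T` are order automorphisms. -/

section EffectMap

variable {𝕜 H : Type*} [RCLike 𝕜] [NormedAddCommGroup H] [InnerProductSpace 𝕜 H] [CompleteSpace H]
  {σ : 𝕜 →+* 𝕜} [IsIdOrConj σ]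

/-- The operator `(T* T - I) X + I`, adjoint to `effectDenom T X`. -/
noncomputable def effectCodenom (T : H →SL[σ] H) (X : H →L[𝕜] H) : H →L[𝕜] H :=
  ((semiAdjoint T).comp T - 1) * X + 1

theorem effectCodenom_apply (T : H →SL[σ] H) (X : H →L[𝕜] H) (v : H) :
    effectCodenom T X v = semiAdjoint T (T (X v)) + (v - X v) := by
  simp only [effectCodenom, add_apply, mul_apply_eq_comp, sub_apply,
    ContinuousLinearMap.comp_apply, one_apply_eq_self]
  abel

theorem effectDenom_apply (T : H →SL[σ] H) (X : H →L[𝕜] H) (v : H) :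
    effectDenom T X v = X (semiAdjoint T (T v)) - X v + v := by
  simp only [effectDenom, add_apply, mul_apply_eq_comp, sub_apply,
    ContinuousLinearMap.comp_apply, one_apply_eq_self, map_sub]

theorem inner_effectCodenom (T : H →SL[σ] H) (X : effects 𝕜 H) (v w : H) :
    ⟪effectCodenom T X.1 v, w⟫_𝕜 = ⟪v, effectDenom T X.1 w⟫_𝕜 := by
  rw [effectCodenom_apply, effectDenom_apply, inner_add_left, inner_sub_left, inner_add_right,
    inner_sub_right, ← effects.inner_apply, ← effects.inner_apply, inner_semiAdjoint_left,
    inner_semiAdjoint_right]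
  abel

theorem re_inner_effectCodenom (T : H →SL[σ] H) (X : H →L[𝕜] H) (v : H) :
    RCLike.re ⟪X v, effectCodenom T X v⟫_𝕜 =
      ‖T (X v)‖ ^ 2 + (RCLike.re ⟪X v, v⟫_𝕜 - ‖X v‖ ^ 2) := by
  rw [effectCodenom_apply, inner_add_right, inner_sub_right, inner_semiAdjoint_right, map_add,
    map_sub, IsIdOrConj.re_apply, inner_self_eq_norm_sq, inner_self_eq_norm_sq]

/-- Pairing with `X v` gives `‖T (X v)‖²` plus a nonnegative energy. This bounds `X v`, and then
`v`, by the image of `v`. -/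
theorem isUnit_effectCodenom {T : H →SL[σ] H} (hT : Function.Bijective T) (X : effects 𝕜 H) :
    IsUnit (effectCodenom T X.1) := by
  obtain ⟨c, hc, hTc⟩ := T.exists_pos_norm_le hT
  have hX : ∀ v, c ^ 2 * ‖X.1 v‖ ≤ ‖effectCodenom T X.1 v‖ := by
    intro v
    by_cases h0 : X.1 v = 0
    · simp [h0]
    have h1 := re_inner_effectCodenom T X.1 v
    have h2 := effects.norm_apply_sq_le X v
    have h3 := (RCLike.re_le_norm ⟪X.1 v, effectCodenom T X.1 v⟫_𝕜).trans
      (norm_inner_le_norm (𝕜 := 𝕜) _ _)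
    have h4 : (c * ‖X.1 v‖) ^ 2 ≤ ‖T (X.1 v)‖ ^ 2 := by
      have := hTc (X.1 v)
      gcongr
    have h5 : 0 < ‖X.1 v‖ := norm_pos_iff.2 h0
    refine le_of_mul_le_mul_left ?_ h5
    nlinarith
  have hbound : ∀ v, ‖v‖ ≤ (1 + (‖(semiAdjoint T).comp T‖ + 1) / c ^ 2) *
      ‖effectCodenom T X.1 v‖ := by
    intro v
    have h1 : v = effectCodenom T X.1 v - ((semiAdjoint T).comp T (X.1 v) - X.1 v) := by
      rw [effectCodenom_apply, ContinuousLinearMap.comp_apply]; abel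
    have h2 : ‖X.1 v‖ ≤ ‖effectCodenom T X.1 v‖ / c ^ 2 := by
      rw [le_div_iff₀ (by positivity), mul_comm]; exact hX v
    calc ‖v‖ = ‖effectCodenom T X.1 v - ((semiAdjoint T).comp T (X.1 v) - X.1 v)‖ := by
          rw [← h1]
      _ ≤ ‖effectCodenom T X.1 v‖ + (‖(semiAdjoint T).comp T (X.1 v)‖ + ‖X.1 v‖) :=
          (norm_sub_le _ _).trans (by gcongr; exact norm_sub_le _ _)
      _ ≤ ‖effectCodenom T X.1 v‖ + (‖(semiAdjoint T).comp T‖ * ‖X.1 v‖ + ‖X.1 v‖) := by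
          gcongr; exact ContinuousLinearMap.le_opNorm _ _
      _ = ‖effectCodenom T X.1 v‖ + (‖(semiAdjoint T).comp T‖ + 1) * ‖X.1 v‖ := by ring
      _ ≤ ‖effectCodenom T X.1 v‖ + (‖(semiAdjoint T).comp T‖ + 1) *
          (‖effectCodenom T X.1 v‖ / c ^ 2) := by gcongr
      _ = _ := by ring
  rw [ContinuousLinearMap.isUnit_iff_bijective,
    ContinuousLinearMap.bijective_iff_dense_range_and_antilipschitz]
  refine ⟨?_, Real.toNNReal (1 + (‖(semiAdjoint T).comp T‖ + 1) / c ^ 2),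
    ContinuousLinearMap.antilipschitz_of_bound _ fun v => ?_⟩
  · rw [Submodule.topologicalClosure_eq_top_iff, Submodule.eq_bot_iff]
    intro x hx
    have h1 : effectDenom T X.1 x = 0 := by
      refine ext_inner_left 𝕜 fun v => ?_
      rw [← inner_effectCodenom, inner_zero_right]
      exact hx _ ⟨v, rfl⟩
    rw [effectDenom_apply] at h1
    -- A vector in the kernel of the adjoint has the form `X y` with `y` in the kernel of
    -- `effectCodenom T X`, which the lower bound makes trivial.
    have hz : x = X.1 (x - semiAdjoint T (T x)) := by
      rw [map_sub, eq_comm, ← sub_eq_zero, ← neg_eq_zero, ← h1]; abel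
    have h2 : effectCodenom T X.1 (x - semiAdjoint T (T x)) = 0 := by
      rw [effectCodenom_apply, ← hz]; abel
    have h3 := hbound (x - semiAdjoint T (T x))
    rw [h2, norm_zero, mul_zero] at h3
    rw [hz, norm_le_zero_iff.1 h3, map_zero]
  · rw [Real.coe_toNNReal _ (by positivity)]
    exact hbound v

theorem isUnit_effectDenom {T : H →SL[σ] H} (hT : Function.Bijective T) (X : effects 𝕜 H) :
    IsUnit (effectDenom T X.1) := by
  have h : effectDenom T X.1 = star (effectCodenom T X.1) := by
    rw [ContinuousLinearMap.star_eq_adjoint]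
    ext w
    refine ext_inner_left 𝕜 fun v => ?_
    rw [ContinuousLinearMap.adjoint_inner_right, inner_effectCodenom]
  rw [h]
  exact (isUnit_effectCodenom hT X).star

/-- The identity `X * effectCodenom T X = effectDenom T X * X` cancels the inverse, so `φ_T(X)` can
be computed by solving one linear equation. -/
theorem effectMap_apply {T : H →SL[σ] H} (hT : Function.Bijective T) (X : effects 𝕜 H) {v w : H}
    (h : effectCodenom T X.1 v = semiAdjoint T w) : effectMap T X.1 w = T (X.1 v) := by
  simp only [effectMap, ContinuousLinearMap.comp_apply, mul_apply_eq_comp, ← h]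
  have h1 : X.1 * effectCodenom T X.1 = effectDenom T X.1 * X.1 := by
    rw [effectCodenom, effectDenom]; noncomm_ring
  have h2 : X.1 (effectCodenom T X.1 v) = effectDenom T X.1 (X.1 v) :=
    congrArg (fun A : H →L[𝕜] H => A v) h1
  have h3 : Ring.inverse (effectDenom T X.1) * effectDenom T X.1 = 1 :=
    Ring.inverse_mul_cancel _ (isUnit_effectDenom hT X)
  rw [h2]
  exact congrArg T (congrArg (fun A : H →L[𝕜] H => A (X.1 v)) h3)

theorem exists_effectCodenom_eq {T : H →SL[σ] H} (hT : Function.Bijective T) (X : effects 𝕜 H)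
    (w : H) : ∃ v, effectCodenom T X.1 v = semiAdjoint T w :=
  (ContinuousLinearMap.isUnit_iff_bijective.1 (isUnit_effectCodenom hT X)).2 _

theorem re_inner_effectMap {T : H →SL[σ] H} (hT : Function.Bijective T) (X : effects 𝕜 H) {v w : H}
    (h : effectCodenom T X.1 v = semiAdjoint T w) :
    RCLike.re ⟪effectMap T X.1 w, w⟫_𝕜 =
      ‖T (X.1 v)‖ ^ 2 + (RCLike.re ⟪X.1 v, v⟫_𝕜 - ‖X.1 v‖ ^ 2) := by
  rw [effectMap_apply hT X h, inner_semiAdjoint, ← h, IsIdOrConj.re_apply, re_inner_effectCodenom]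

theorem effectMap_mem {T : H →SL[σ] H} (hT : Function.Bijective T) (X : effects 𝕜 H) :
    effectMap T X.1 ∈ effects 𝕜 H := by
  have hsymm : (effectMap T X.1 : H →ₗ[𝕜] H).IsSymmetric := by
    intro w w'
    obtain ⟨v, hv⟩ := exists_effectCodenom_eq hT X w
    obtain ⟨v', hv'⟩ := exists_effectCodenom_eq hT X w'
    change ⟪effectMap T X.1 w, w'⟫_𝕜 = ⟪w, effectMap T X.1 w'⟫_𝕜
    rw [effectMap_apply hT X hv, effectMap_apply hT X hv', inner_semiAdjoint, ← hv']
    have h1 : ⟪w, T (X.1 v')⟫_𝕜 = σ ⟪semiAdjoint T w, X.1 v'⟫_𝕜 := by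
      rw [inner_semiAdjoint_left, IsIdOrConj.apply_apply]
    rw [h1, ← hv, effectCodenom_apply, effectCodenom_apply, inner_add_left, inner_add_right,
      inner_sub_left, inner_sub_right, effects.inner_apply X v v', inner_semiAdjoint_left,
      inner_semiAdjoint_right]
  rw [mem_effects_iff]
  refine ⟨⟨hsymm, fun w => ?_⟩, ⟨LinearMap.IsSymmetric.id.sub hsymm, fun w => ?_⟩⟩
  · obtain ⟨v, hv⟩ := exists_effectCodenom_eq hT X w
    rw [ContinuousLinearMap.reApplyInnerSelf_apply, re_inner_effectMap hT X hv]
    have := effects.norm_apply_sq_le X v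
    have := sq_nonneg ‖T (X.1 v)‖
    linarith
  · obtain ⟨v, hv⟩ := exists_effectCodenom_eq hT X w
    -- The form of `I - φ_T(X)` at `w` becomes `‖w - T (X v)‖²` plus the energy term `⟪X v, v⟫ - ‖X
    -- v‖²`.
    have h0 : w = (w - T (X.1 v)) + T (X.1 v) := by abel
    have h1 : semiAdjoint T (w - T (X.1 v)) = v - X.1 v := by
      rw [map_sub, ← hv, effectCodenom_apply]; abel
    rw [ContinuousLinearMap.reApplyInnerSelf_apply, sub_apply, one_apply_eq_self,
      effectMap_apply hT X hv]
    have h2 : ⟪w - T (X.1 v), w⟫_𝕜 =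
        ⟪w - T (X.1 v), w - T (X.1 v)⟫_𝕜 + ⟪w - T (X.1 v), T (X.1 v)⟫_𝕜 := by
      rw [← inner_add_right, sub_add_cancel]
    have h3 : ⟪w - T (X.1 v), T (X.1 v)⟫_𝕜 = σ ⟪v - X.1 v, X.1 v⟫_𝕜 := by
      rw [← h1, inner_semiAdjoint_left, IsIdOrConj.apply_apply]
    rw [h2, h3, map_add, IsIdOrConj.re_apply, inner_self_eq_norm_sq, inner_sub_left, map_sub,
      inner_self_eq_norm_sq, ← effects.inner_apply]
    have := effects.norm_apply_sq_le X v
    have := sq_nonneg ‖w - T (X.1 v)‖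
    linarith

/-- The map `φ_T` as a self-map of the set of effects. -/
noncomputable def effectAut {T : H →SL[σ] H} (hT : Function.Bijective T) (X : effects 𝕜 H) :
    effects 𝕜 H :=
  ⟨effectMap T X.1, effectMap_mem hT X⟩

theorem effectAut_rankOne {T : H →SL[σ] H} (hT : Function.Bijective T) {x : H} (hx : x ≠ 0)
    (u : NNReal) : effectAut hT (effects.rankOne 𝕜 x u) = effects.rankOne 𝕜 (T x) u := by
  apply Subtype.ext
  ext w
  obtain ⟨v, hv⟩ := exists_effectCodenom_eq hT (effects.rankOne 𝕜 x u) w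
  have hTx : T x ≠ 0 := fun h => hx (hT.1 (h.trans (map_zero T).symm))
  set r : ℝ := ‖x‖ ^ 2 + u with hr
  have hr0 : (r : 𝕜) ≠ 0 := by
    exact_mod_cast (effects.normSq_add_pos hx u).ne'
  set s : ℝ := ‖T x‖ ^ 2 + u with hs
  have hs0 : (s : 𝕜) ≠ 0 := by
    exact_mod_cast (effects.normSq_add_pos hTx u).ne'
  change effectMap T (effects.rankOne 𝕜 x u).1 w = _
  rw [effectMap_apply hT _ hv]
  set α : 𝕜 := ((r⁻¹ : ℝ) : 𝕜) * ⟪x, v⟫_𝕜 with hα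
  have hXv : (effects.rankOne 𝕜 x u).1 v = α • x := effects.rankOne_apply x u v
  have hxv : ⟪x, v⟫_𝕜 = α * r := by
    rw [hα, RCLike.ofReal_inv]; field_simp
  have h1 : ⟪T x, w⟫_𝕜 = σ α * s := by
    rw [inner_semiAdjoint, ← hv, effectCodenom_apply, hXv, inner_add_right, inner_sub_right, hxv,
      inner_semiAdjoint_right, map_smulₛₗ, inner_smul_right, inner_smul_right,
      inner_self_eq_norm_sq_to_K, inner_self_eq_norm_sq_to_K]
    simp only [map_add, map_sub, map_mul, map_pow, IsIdOrConj.apply_apply, IsIdOrConj.apply_ofReal]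
    rw [hr, hs]
    push_cast
    ring
  rw [hXv, effects.rankOne_apply, h1, map_smulₛₗ]
  congr 1
  rw [RCLike.ofReal_inv, ← hs]
  field_simp

theorem effectAut_leftInverse {T S : H →SL[σ] H} (hT : Function.Bijective T)
    (hS : Function.Bijective S) (hST : ∀ x, S (T x) = x) (X : effects 𝕜 H) :
    effectAut hS (effectAut hT X) = X := by
  have hTS' := semiAdjoint_leftInverse hST
  apply Subtype.ext
  ext v
  have hinj := semiAdjoint_injective hT.2
  obtain ⟨w, hw⟩ : ∃ w, semiAdjoint T w = effectCodenom T X.1 v := ⟨_, hTS' _⟩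
  have hZ : (effectAut hT X).1 w = T (X.1 v) := effectMap_apply hT X hw.symm
  have h1 : effectCodenom S (effectAut hT X).1 w = semiAdjoint S v := by
    rw [effectCodenom_apply, hZ, hST]
    apply hinj
    rw [map_add, map_sub, hTS', hTS', hw, effectCodenom_apply]
    abel
  change effectMap S (effectAut hT X).1 v = _
  rw [effectMap_apply hS _ h1, hZ, hST]

/-- By `re_inner_effectMap`, the energy of `φ_T(X)` at `T (X v)` equals that of `X` at `X v`. -/
theorem rankOne_apply_le_effectAut_iff {T : H →SL[σ] H} (hT : Function.Bijective T)
    {X : effects 𝕜 H} {v : H} (hv : X.1 v ≠ 0) {u : NNReal} :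
    effects.rankOne 𝕜 (T (X.1 v)) u ≤ effectAut hT X ↔ effects.rankOne 𝕜 (X.1 v) u ≤ X := by
  obtain ⟨S, hST, hTS⟩ := exists_rightInverse_semilinear hT
  obtain ⟨w, hw⟩ : ∃ w, semiAdjoint T w = effectCodenom T X.1 v :=
    ⟨_, semiAdjoint_leftInverse hST _⟩
  have hZ : (effectAut hT X).1 w = T (X.1 v) := effectMap_apply hT X hw.symm
  have h1 : RCLike.re ⟪(effectAut hT X).1 w, w⟫_𝕜 = _ := re_inner_effectMap hT X hw.symm
  have hTX : T (X.1 v) ≠ 0 := fun h => hv (hT.1 (h.trans (map_zero T).symm))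
  rw [effects.rankOne_apply_le_iff hv, ← hZ, effects.rankOne_apply_le_iff (by rwa [hZ]), h1, hZ]
  constructor <;> intro h <;> linarith

/-- Energies are compared only at vectors in the range of the effect; surjectivity puts `X v` in the
range of `Y`. -/
theorem effectAut_le_of_surjective {T : H →SL[σ] H} (hT : Function.Bijective T) {X Y : effects 𝕜 H}
    (h : X ≤ Y) (hY : Function.Surjective Y.1) : effectAut hT X ≤ effectAut hT Y := by
  refine effects.le_of_forall_rankOne_le fun w u hw hu => ?_
  obtain ⟨v, hv⟩ := exists_effectCodenom_eq hT X w
  have hZ : (effectAut hT X).1 w = T (X.1 v) := effectMap_apply hT X hv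
  rw [hZ] at hw hu ⊢
  have hv0 : X.1 v ≠ 0 := fun h => hw (by rw [h, map_zero])
  have h1 := ((rankOne_apply_le_effectAut_iff hT hv0).1 hu).trans h
  obtain ⟨v', hv'⟩ := hY (X.1 v)
  rw [← hv'] at h1 hv0 ⊢
  exact (rankOne_apply_le_effectAut_iff hT hv0).2 h1

theorem effects.towardsOne_surjective (Y : effects 𝕜 H) (ε : ℝ) (hε : ε ∈ Set.Icc (0 : ℝ) 1)
    (hε0 : 0 < ε) : Function.Surjective (effects.towardsOne Y ε hε).1 := by
  have h : IsUnit (effects.towardsOne Y ε hε).1 := by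
    refine ContinuousLinearMap.isUnit_of_forall_le_norm_inner_map _ (c := Real.toNNReal ε)
      (Real.toNNReal_pos.2 hε0) fun x => ?_
    refine le_trans ?_ (RCLike.re_le_norm _)
    rw [effects.re_inner_towardsOne, Real.coe_toNNReal _ hε.1]
    nlinarith [(effects.isPositive Y).re_inner_nonneg_left x, hε.2]
  exact (ContinuousLinearMap.isUnit_iff_bijective.1 h).2

theorem tendsto_effectMap {T : H →SL[σ] H} (hT : Function.Bijective T) (Y : effects 𝕜 H) (w : H) :
    Filter.Tendsto (fun ε : ℝ => effectMap T (Y.1 + (ε : 𝕜) • (1 - Y.1)) w)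
      (nhdsWithin 0 (Set.Ioi 0)) (nhds (effectMap T Y.1 w)) := by
  have hc : ContinuousAt (fun ε : ℝ => effectMap T (Y.1 + (ε : 𝕜) • (1 - Y.1)) w) 0 := by
    have hX : Continuous fun ε : ℝ => Y.1 + (ε : 𝕜) • (1 - Y.1) := by fun_prop
    have hD : Continuous fun ε : ℝ => effectDenom T (Y.1 + (ε : 𝕜) • (1 - Y.1)) := by
      unfold effectDenom; fun_prop
    have hI : ContinuousAt (fun ε : ℝ =>
        Ring.inverse (effectDenom T (Y.1 + (ε : 𝕜) • (1 - Y.1)))) 0 := by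
      refine ContinuousAt.comp (g := Ring.inverse) ?_ hD.continuousAt
      obtain ⟨U, hU⟩ := isUnit_effectDenom hT Y
      have := NormedRing.inverse_continuousAt U
      rw [hU] at this
      simpa using this
    have h1 := hI.mul hX.continuousAt
    have h2 := T.continuous.continuousAt.comp
      (h1.clm_apply (continuousAt_const (y := semiAdjoint T w)))
    exact h2
  have := hc.tendsto
  simp only [RCLike.ofReal_zero, zero_smul, add_zero] at this
  exact this.mono_left nhdsWithin_le_nhds

theorem effectAut_mono {T : H →SL[σ] H} (hT : Function.Bijective T) {X Y : effects 𝕜 H}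
    (h : X ≤ Y) : effectAut hT X ≤ effectAut hT Y := by
  rw [effects.le_iff]
  intro w
  -- The surjective effects `Y + ε (I - Y)` dominate `X`, and their images tend to `φ_T(Y)` as `ε`
  -- decreases to zero.
  have hlim : Filter.Tendsto
      (fun ε : ℝ => RCLike.re ⟪effectMap T (Y.1 + (ε : 𝕜) • (1 - Y.1)) w, w⟫_𝕜)
      (nhdsWithin 0 (Set.Ioi 0)) (nhds (RCLike.re ⟪effectMap T Y.1 w, w⟫_𝕜)) :=
    (RCLike.continuous_re.tendsto _).comp ((tendsto_effectMap hT Y w).inner tendsto_const_nhds)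
  refine ge_of_tendsto hlim ?_
  filter_upwards [Ioc_mem_nhdsGT (zero_lt_one' ℝ)] with ε hε
  have hε' : ε ∈ Set.Icc (0 : ℝ) 1 := ⟨hε.1.le, hε.2⟩
  have hle : X ≤ effects.towardsOne Y ε hε' := h.trans (effects.le_iff.2 fun x => by
    rw [effects.re_inner_towardsOne]
    have := effects.re_inner_apply_le Y x
    nlinarith [hε.1])
  exact effects.le_iff.1 (effectAut_le_of_surjective hT hle
    (effects.towardsOne_surjective Y ε hε' hε.1)) w

theorem isOrderAutomorphism_effectAut {T : H →SL[σ] H} (hT : Function.Bijective T) :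
    IsOrderAutomorphism (effectAut hT) := by
  obtain ⟨S, hST, hTS⟩ := exists_rightInverse_semilinear hT
  have hS : Function.Bijective S :=
    ⟨Function.LeftInverse.injective hTS, Function.RightInverse.surjective hST⟩
  refine ⟨⟨Function.LeftInverse.injective (effectAut_leftInverse hT hS hST),
    Function.RightInverse.surjective (effectAut_leftInverse hS hT hTS)⟩, fun X Y =>
    ⟨effectAut_mono hT, fun h => ?_⟩⟩
  have := effectAut_mono hS h
  rwa [effectAut_leftInverse hT hS hST, effectAut_leftInverse hT hS hST] at this

end EffectMap

/-! ### Uniqueness of `T` up to a unimodular scalar. -/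

section Uniqueness

variable {𝕜 H : Type*} [RCLike 𝕜] [NormedAddCommGroup H] [InnerProductSpace 𝕜 H]

/-- Additivity at `x + y` forces equal scalars at independent `x` and `y`; dependent vectors are
compared through a third one. Only additivity of `T` is required, since its field automorphism may a
priori differ from `τ`. -/
theorem exists_forall_eq_smul (hdim : 3 ≤ Module.rank 𝕜 H) {τ : 𝕜 →+* 𝕜} [IsIdOrConj τ]
    {T : H → H} (hT : ∀ x y, T (x + y) = T x + T y) {S : H →SL[τ] H}
    (hS : Function.Injective S) (h : ∀ x, x ≠ 0 → ∃ c : 𝕜, ‖c‖ = 1 ∧ T x = c • S x) :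
    ∃ c : 𝕜, ‖c‖ = 1 ∧ ∀ x, T x = c • S x := by
  have key : ∀ (x y : H) (c : 𝕜), x ≠ 0 → y ∉ Submodule.span 𝕜 {x} → T x = c • S x →
      T y = c • S y := by
    intro x y c hx hy hc
    have hy0 : y ≠ 0 := by rintro rfl; simp at hy
    have hxy : x + y ≠ 0 := fun h => hy
      (Submodule.mem_span_singleton.2 ⟨-1, by rw [eq_neg_of_add_eq_zero_right h]; simp⟩)
    have hSy : S y ∉ Submodule.span 𝕜 {S x} := fun h => by
      obtain ⟨a, ha⟩ := Submodule.mem_span_singleton.1 h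
      refine hy (Submodule.mem_span_singleton.2 ⟨τ a, hS ?_⟩)
      rw [map_smulₛₗ, IsIdOrConj.apply_apply, ha]
    obtain ⟨d, -, hd⟩ := h y hy0
    obtain ⟨e, -, he⟩ := h (x + y) hxy
    rw [hT, hc, hd, map_add, smul_add, ← sub_eq_zero] at he
    have hSx : S x ≠ 0 := fun h => hx (hS (h.trans (map_zero S).symm))
    have hde : d = e := by
      by_contra hde
      refine hSy ((Submodule.smul_mem_iff _ (sub_ne_zero.2 hde)).1
        (Submodule.mem_span_singleton.2 ⟨e - c, ?_⟩))
      rw [← sub_eq_zero, ← neg_eq_zero, ← he]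
      module
    subst hde
    have : (c - d) • S x = 0 := by rw [← he]; module
    have hcd : c = d := sub_eq_zero.1 ((smul_eq_zero.1 this).resolve_right hSx)
    rw [hd, hcd]
  obtain ⟨x, hx⟩ := IsCollineation.notMem_span_of_le_rank hdim (0 : H) 0
  have hx0 : x ≠ 0 := by rintro rfl; simp at hx
  obtain ⟨z, hz⟩ := IsCollineation.notMem_span_of_le_rank hdim x x
  rw [Set.pair_eq_singleton] at hz
  have hz0 : z ≠ 0 := by rintro rfl; simp at hz
  obtain ⟨c, hc1, hc⟩ := h x hx0
  refine ⟨c, hc1, fun y => ?_⟩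
  by_cases hy0 : y = 0
  · have h0 : T 0 = 0 := by simpa using hT 0 0
    simp [hy0, h0]
  by_cases hy : y ∈ Submodule.span 𝕜 {x}
  · refine key z y c hz0 (fun h => hz ?_) (key x z c hx0 hz hc)
    obtain ⟨a, rfl⟩ := Submodule.mem_span_singleton.1 h
    have ha : a ≠ 0 := by rintro rfl; simp at hy0
    exact (Submodule.smul_mem_iff _ ha).1 hy
  · exact key x y c hx0 hy hc

/-- A positive energy level is essential: at level zero rescaling the vector does not change the
effect. -/
theorem exists_norm_eq_one_of_rankOne_eq {x y : H} (hx : x ≠ 0)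
    (h : effects.rankOne 𝕜 x 1 = effects.rankOne 𝕜 y 1) : ∃ c : 𝕜, ‖c‖ = 1 ∧ x = c • y := by
  obtain ⟨c, rfl⟩ := Submodule.mem_span_singleton.1 (effects.mem_span_of_rankOne_le hx h.le)
  have hc : c ≠ 0 := by rintro rfl; simp at hx
  have hy : y ≠ 0 := by rintro rfl; simp at hx
  refine ⟨c, ?_, rfl⟩
  have h1 := effects.rankOne_smul hc y ((‖c‖₊ ^ 2)⁻¹)
  have hc' : ‖c‖₊ ^ 2 ≠ 0 := by simpa using hc
  rw [mul_inv_cancel₀ hc', h] at h1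
  have h2 := le_antisymm ((effects.rankOne_le_rankOne_iff hy).1 h1.ge)
    ((effects.rankOne_le_rankOne_iff hy).1 h1.le)
  have h3 : ‖c‖₊ = 1 := by
    rw [eq_comm, inv_eq_one] at h2
    exact (pow_eq_one_iff_of_nonneg zero_le two_ne_zero).1 h2
  simpa using congrArg NNReal.toReal h3

theorem eq_smul_of_effectMap_eq [CompleteSpace H] (hdim : 3 ≤ Module.rank 𝕜 H)
    {σ τ : 𝕜 →+* 𝕜} [IsIdOrConj σ] [IsIdOrConj τ] {T : H →SL[σ] H} {S : H →SL[τ] H} (hT : Function.Bijective T)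
    (hS : Function.Bijective S) (h : ∀ X ∈ effects 𝕜 H, effectMap T X = effectMap S X) :
    ∃ c : 𝕜, ‖c‖ = 1 ∧ ∀ x : H, T x = c • S x := by
  refine exists_forall_eq_smul hdim (map_add T) hS.1 fun x hx => ?_
  refine exists_norm_eq_one_of_rankOne_eq
    (fun h => hx (hT.1 (h.trans (map_zero T).symm))) ?_
  rw [← effectAut_rankOne hT hx, ← effectAut_rankOne hS hx]
  exact Subtype.ext (h _ (effects.rankOne 𝕜 x 1).2)

end Uniqueness

/-! ### Norm preserving endomorphisms of the scalar field. -/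

section NormPreserving

variable {𝕜 : Type*} [RCLike 𝕜]

/-- Rational scalars are fixed by `σ`, and their norms separate distinct real values. -/
theorem norm_map_eq_of_norm_le_iff {σ : 𝕜 →+* 𝕜} (h : ∀ c d, ‖c‖ ≤ ‖d‖ ↔ ‖σ c‖ ≤ ‖σ d‖) (c : 𝕜) :
    ‖σ c‖ = ‖c‖ := by
  have hq : ∀ q : ℚ, 0 ≤ (q : ℝ) → ‖(q : 𝕜)‖ = q ∧ ‖σ (q : 𝕜)‖ = q := by
    intro q hq
    have : ‖(q : 𝕜)‖ = q := by
      rw [← RCLike.ofReal_ratCast, RCLike.norm_ofReal, abs_of_nonneg hq]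
    exact ⟨this, by rw [map_ratCast]; exact this⟩
  rcases lt_trichotomy ‖σ c‖ ‖c‖ with hlt | heq | hlt
  · obtain ⟨q, h1, h2⟩ := exists_rat_btwn hlt
    obtain ⟨h3, h4⟩ := hq q ((norm_nonneg _).trans h1.le)
    have := (h q c).1 (by rw [h3]; exact h2.le)
    rw [h4] at this
    exact absurd this (not_le.2 h1)
  · exact heq
  · obtain ⟨q, h1, h2⟩ := exists_rat_btwn hlt
    obtain ⟨h3, h4⟩ := hq q ((norm_nonneg _).trans h1.le)
    have := (h c q).1 (by rw [h3]; exact h1.le)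
    rw [h4] at this
    exact absurd this (not_le.2 h2)

/-- An isometric endomorphism is continuous, hence fixes the reals, and it sends `RCLike.I` to a
square root of `-1` unless `RCLike.I = 0`. -/
theorem isIdOrConj_of_norm_map {σ : 𝕜 →+* 𝕜} (h : ∀ c, ‖σ c‖ = ‖c‖) : IsIdOrConj σ := by
  have hcont : Continuous σ :=
    (AddMonoidHomClass.isometry_of_norm σ h).continuous
  have hreal : ∀ r : ℝ, σ (r : 𝕜) = r := by
    intro r
    have := map_real_smul σ hcont r 1
    rwa [map_one, RCLike.real_smul_eq_coe_mul, mul_one] at this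
  have hdecomp : ∀ z : 𝕜, σ z = RCLike.re z + RCLike.im z * σ RCLike.I := by
    intro z
    conv_lhs => rw [← RCLike.re_add_im z]
    rw [map_add, map_mul, hreal, hreal]
  rcases RCLike.I_mul_I (K := 𝕜) with hI | hI
  · refine ⟨Or.inl (RingHom.ext fun z => ?_)⟩
    rw [hdecomp, hI, map_zero, RingHom.id_apply]
    conv_rhs => rw [← RCLike.re_add_im z, hI]
  · have h2 : (σ RCLike.I - RCLike.I) * (σ RCLike.I + RCLike.I) = 0 := by
      have : σ RCLike.I * σ RCLike.I = -1 := by rw [← map_mul, hI, map_neg, map_one]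
      linear_combination this - hI
    rcases mul_eq_zero.1 h2 with h3 | h3
    · refine ⟨Or.inl (RingHom.ext fun z => ?_)⟩
      rw [hdecomp, sub_eq_zero.1 h3, RCLike.re_add_im, RingHom.id_apply]
    · refine ⟨Or.inr (RingHom.ext fun z => ?_)⟩
      rw [hdecomp, eq_neg_of_add_eq_zero_left h3]
      conv_rhs => rw [← RCLike.re_add_im z]
      rw [map_add, map_mul, RCLike.conj_ofReal, RCLike.conj_ofReal, RCLike.conj_I]

end NormPreserving

/-! ### Test effects: projections, `(I + a ⊗ a*)⁻¹` and `I / 2`. -/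

namespace effects

variable {𝕜 H : Type*} [RCLike 𝕜] [NormedAddCommGroup H] [InnerProductSpace 𝕜 H]

theorem exists_eq_rankOne_of_le {y z : H} (hy : y ≠ 0) {w w' : NNReal}
    (h : rankOne 𝕜 y w ≤ rankOne 𝕜 z w') : ∃ w'', rankOne 𝕜 y w = rankOne 𝕜 z w'' := by
  obtain ⟨c, rfl⟩ := Submodule.mem_span_singleton.1 (mem_span_of_rankOne_le hy h)
  have hc : c ≠ 0 := by rintro rfl; simp at hy
  have hc' : ‖c‖₊ ^ 2 ≠ 0 := by simpa using hc
  refine ⟨(‖c‖₊ ^ 2)⁻¹ * w, ?_⟩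
  rw [← rankOne_smul hc z, mul_inv_cancel_left₀ hc']

/-- This phrases coplanarity in terms of the order. The test effect for the converse is the
projection onto the span. -/
theorem mem_span_pair_iff [CompleteSpace H] {x y z : H} (hx : x ≠ 0) (hy : y ≠ 0) (hz : z ≠ 0) :
    z ∈ Submodule.span 𝕜 {x, y} ↔ ∀ A : effects 𝕜 H, rankOne 𝕜 x 0 ≤ A → rankOne 𝕜 y 0 ≤ A →
      rankOne 𝕜 z 0 ≤ A := by
  constructor
  · intro h A hxA hyA
    rw [rankOne_zero_le_iff hx] at hxA
    rw [rankOne_zero_le_iff hy] at hyA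
    rw [rankOne_zero_le_iff hz]
    obtain ⟨a, b, rfl⟩ := Submodule.mem_span_pair.1 h
    rw [map_add, map_smul, map_smul, hxA, hyA]
  · intro h
    have : FiniteDimensional 𝕜 (Submodule.span 𝕜 {x, y}) :=
      FiniteDimensional.span_of_finite 𝕜 (Set.toFinite _)
    let U := Submodule.span 𝕜 {x, y}
    let A : effects 𝕜 H := ⟨U.starProjection, by
      rw [mem_effects_iff]
      refine ⟨ContinuousLinearMap.IsPositive.of_isStarProjection isStarProjection_starProjection,
        ContinuousLinearMap.IsPositive.of_isStarProjection
          isStarProjection_starProjection.one_sub⟩⟩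
    have key : ∀ {v : H}, v ≠ 0 → (rankOne 𝕜 v 0 ≤ A ↔ v ∈ U) := fun hv =>
      (rankOne_zero_le_iff hv).trans Submodule.starProjection_eq_self_iff
    exact (key hz).1 (h A ((key hx).2 (Submodule.subset_span (by simp)))
      ((key hy).2 (Submodule.subset_span (by simp))))

/-- The effect `(I + a ⊗ a*)⁻¹`. -/
noncomputable def invOneAdd (𝕜 : Type*) {H : Type*} [RCLike 𝕜] [NormedAddCommGroup H]
    [InnerProductSpace 𝕜 H] (a : H) : effects 𝕜 H :=
  ⟨1 - (rankOne 𝕜 a 1).1, by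
    rw [mem_effects_iff, sub_sub_cancel]
    exact ⟨isPositive_one_sub _, isPositive _⟩⟩

theorem rankOne_le_invOneAdd_iff {a x : H} (hx : x ≠ 0) {u : NNReal} :
    rankOne 𝕜 x u ≤ invOneAdd 𝕜 a ↔ ‖⟪a, x⟫_𝕜‖ ^ 2 ≤ u := by
  have hB : ∀ v, (invOneAdd 𝕜 a).1 v = v - ((((‖a‖ ^ 2 + 1)⁻¹ : ℝ) : 𝕜) * ⟪a, v⟫_𝕜) • a := by
    intro v
    change v - (rankOne 𝕜 a 1).1 v = _
    rw [rankOne_apply]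
    simp
  have h0 : ((‖a‖ : 𝕜) ^ 2 + 1) ≠ 0 := by
    have : (‖a‖ ^ 2 + 1 : ℝ) ≠ 0 := by positivity
    exact_mod_cast this
  -- The preimage of `x` is found by applying `I + a ⊗ a*`.
  have h1 : (invOneAdd 𝕜 a).1 (x + ⟪a, x⟫_𝕜 • a) = x := by
    rw [hB, inner_add_right, inner_smul_right, inner_self_eq_norm_sq_to_K]
    have : (((‖a‖ ^ 2 + 1)⁻¹ : ℝ) : 𝕜) * (⟪a, x⟫_𝕜 + ⟪a, x⟫_𝕜 * (‖a‖ : 𝕜) ^ 2) = ⟪a, x⟫_𝕜 := by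
      push_cast
      field_simp
      ring
    rw [this, add_sub_cancel_right]
  have h2 := rankOne_apply_le_iff (A := invOneAdd 𝕜 a) (v := x + ⟪a, x⟫_𝕜 • a) (u := u)
    (by rwa [h1])
  rw [h1, inner_add_right, inner_smul_right, map_add, inner_self_eq_norm_sq,
    ← inner_conj_symm x a, RCLike.mul_conj, ← RCLike.ofReal_pow, RCLike.ofReal_re,
    add_le_add_iff_left] at h2
  exact h2

theorem eq_invOneAdd {C : effects 𝕜 H} {d : H} {r : ℝ} (hr : 0 ≤ r) (hrd : r * ‖d‖ ^ 2 < 1)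
    (h : 1 - C.1 = (r : 𝕜) • InnerProductSpace.rankOne 𝕜 d d) : ∃ a, C = invOneAdd 𝕜 a := by
  have hp : 0 < 1 - r * ‖d‖ ^ 2 := by linarith
  -- `κ` solves `κ² / (κ² ‖d‖² + 1) = r`, which matches the rank one parts.
  set κ : ℝ := Real.sqrt (r / (1 - r * ‖d‖ ^ 2)) with hκ
  have hκ2 : κ ^ 2 = r / (1 - r * ‖d‖ ^ 2) := Real.sq_sqrt (by positivity)
  refine ⟨(κ : 𝕜) • d, Subtype.ext ?_⟩
  have h1 : C.1 = 1 - (r : 𝕜) • InnerProductSpace.rankOne 𝕜 d d := by rw [← h]; abel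
  have h2 : (‖(κ : 𝕜) • d‖ ^ 2 + 1)⁻¹ * κ ^ 2 = r := by
    rw [norm_smul, RCLike.norm_ofReal, mul_pow, sq_abs, hκ2]
    have : r / (1 - r * ‖d‖ ^ 2) * ‖d‖ ^ 2 + 1 = (1 - r * ‖d‖ ^ 2)⁻¹ := by
      field_simp
      ring
    rw [this, inv_inv]
    field_simp
  rw [h1]
  change 1 - _ = 1 - (rankOne 𝕜 ((κ : 𝕜) • d) 1).1
  congr 1
  ext v
  rw [rankOne_apply, smul_apply, InnerProductSpace.rankOne_apply, smul_smul, smul_smul,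
    inner_smul_left, RCLike.conj_ofReal]
  congr 1
  rw [NNReal.coe_one]
  calc (r : 𝕜) * ⟪d, v⟫_𝕜 = (((‖(κ : 𝕜) • d‖ ^ 2 + 1)⁻¹ * κ ^ 2 : ℝ) : 𝕜) * ⟪d, v⟫_𝕜 := by rw [h2]
    _ = _ := by
      rw [RCLike.ofReal_mul, RCLike.ofReal_pow]; ring

/-- The effect `I / 2`. -/
noncomputable def half (𝕜 H : Type*) [RCLike 𝕜] [NormedAddCommGroup H]
    [InnerProductSpace 𝕜 H] : effects 𝕜 H :=
  ⟨((2⁻¹ : ℝ) : 𝕜) • 1, by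
    rw [mem_effects_iff]
    have h1 : (1 : H →L[𝕜] H) - ((2⁻¹ : ℝ) : 𝕜) • 1 = ((2⁻¹ : ℝ) : 𝕜) • 1 := by
      push_cast; module
    rw [h1, and_self]
    have h2 : (0 : ℝ) ≤ 2⁻¹ := by norm_num
    exact ContinuousLinearMap.isPositive_one.smul_of_nonneg (by exact_mod_cast h2)⟩

theorem rankOne_le_half_iff {x : H} (hx : x ≠ 0) {u : NNReal} :
    rankOne 𝕜 x u ≤ half 𝕜 H ↔ ‖x‖ ^ 2 ≤ u := by
  have h1 : ∀ v, (half 𝕜 H).1 v = ((2⁻¹ : ℝ) : 𝕜) • v := fun v => rfl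
  have h2 : (half 𝕜 H).1 ((2 : 𝕜) • x) = x := by
    rw [h1, smul_smul]; push_cast; rw [inv_mul_cancel₀ two_ne_zero, one_smul]
  have h3 := rankOne_apply_le_iff (A := half 𝕜 H) (v := (2 : 𝕜) • x) (u := u) (by rwa [h2])
  rw [h2, inner_smul_right] at h3
  have h4 : RCLike.re ((2 : 𝕜) * ⟪x, x⟫_𝕜) = 2 * ‖x‖ ^ 2 := by
    rw [two_mul, map_add, inner_self_eq_norm_sq]; ring
  rw [h4, two_mul, add_le_add_iff_left] at h3
  exact h3

end effects

/-! ### The action of an order automorphism on lines. -/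

namespace IsOrderAutomorphism

section

variable {α : Type*} [PartialOrder α] {M : Set α} {φ : M → M}

/-- The inverse of an order automorphism. -/
noncomputable def inv (h : IsOrderAutomorphism φ) : M → M :=
  (Equiv.ofBijective φ h.1).symm

theorem apply_inv (h : IsOrderAutomorphism φ) (X : M) : φ (h.inv X) = X :=
  Equiv.ofBijective_apply_symm_apply φ h.1 X

theorem inv_le_inv_iff (h : IsOrderAutomorphism φ) (X Y : M) : h.inv X ≤ h.inv Y ↔ X ≤ Y := by
  rw [h.2 (h.inv X), h.apply_inv, h.apply_inv]

theorem symm (h : IsOrderAutomorphism φ) : IsOrderAutomorphism h.inv :=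
  ⟨Equiv.bijective _, fun X Y => (h.inv_le_inv_iff X Y).symm⟩

end

variable {𝕜 H : Type*} [RCLike 𝕜] [NormedAddCommGroup H] [InnerProductSpace 𝕜 H]
  {φ : effects 𝕜 H → effects 𝕜 H}

open effects

theorem coe_ne_zero (h : IsOrderAutomorphism φ) {X : effects 𝕜 H} (hX : X.1 ≠ 0) :
    (φ X).1 ≠ 0 := by
  intro h0
  -- `rankOne 𝕜 0 0` is the zero effect.
  have h1 : φ X ≤ φ (rankOne 𝕜 0 0) := by
    change (φ X).1 ≤ _
    rw [h0]
    exact (φ _).2.1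
  have h2 : X.1 ≤ 0 := by
    have h3 : X.1 ≤ (rankOne 𝕜 (0 : H) 0).1 := (h.2 _ _).2 h1
    rwa [rankOne_coe, (InnerProductSpace.rankOne_eq_zero (𝕜 := 𝕜)).2 (Or.inl rfl),
      smul_zero] at h3
  exact hX (le_antisymm h2 X.2.1)

theorem exists_rankOne (h : IsOrderAutomorphism φ) {x : H} (hx : x ≠ 0) (u : NNReal) :
    ∃ y w, y ≠ 0 ∧ φ (rankOne 𝕜 x u) = rankOne 𝕜 y w := by
  refine exists_eq_rankOne (h.coe_ne_zero (rankOne_ne_zero hx u)) fun Y Z hY hZ => ?_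
  have key : ∀ Y, Y ≤ φ (rankOne 𝕜 x u) →
      h.inv Y ≤ rankOne 𝕜 x u := fun Y hY => by
    rw [h.2, h.apply_inv]; exact hY
  have := le_total_of_le_rankOne hx (key Y hY) (key Z hZ)
  rwa [h.inv_le_inv_iff, h.inv_le_inv_iff] at this

/-- Projections are maximal among rank one effects: the preimage of the projection above the image
is a rank one effect above `rankOne 𝕜 x 0`, hence equal to it. -/
theorem exists_rankOne_zero (h : IsOrderAutomorphism φ) {x : H} (hx : x ≠ 0) :
    ∃ y, y ≠ 0 ∧ φ (rankOne 𝕜 x 0) = rankOne 𝕜 y 0 := by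
  obtain ⟨y, w, hy, hw⟩ := h.exists_rankOne hx 0
  refine ⟨y, hy, ?_⟩
  obtain ⟨x', u', hx', hu'⟩ := h.symm.exists_rankOne hy 0
  have hu'' : rankOne 𝕜 y 0 = φ (rankOne 𝕜 x' u') := by rw [← hu', h.apply_inv]
  have h1 : rankOne 𝕜 x 0 ≤ rankOne 𝕜 x' u' := by
    rw [h.2, hw, ← hu'', rankOne_le_rankOne_iff hy]
    exact zero_le
  obtain ⟨w', hw'⟩ := exists_eq_rankOne_of_le hx h1
  have hle : u' ≤ w' := by rwa [hw', rankOne_le_rankOne_iff hx'] at h1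
  obtain ⟨c, hc⟩ := Submodule.mem_span_singleton.1 (mem_span_of_rankOne_le hx h1)
  have hc0 : c ≠ 0 := by rintro rfl; simp at hc; exact hx hc.symm
  have h2 := rankOne_smul (𝕜 := 𝕜) hc0 x' u'
  rw [hc] at h2
  rw [← h2, rankOne_le_rankOne_iff hx] at h1
  rw [hu'', ← h2, le_antisymm h1 zero_le]

theorem exists_isCollineation [CompleteSpace H] (h : IsOrderAutomorphism φ) :
    ∃ g : H → H, IsCollineation 𝕜 g ∧ ∀ x, x ≠ 0 → φ (rankOne 𝕜 x 0) = rankOne 𝕜 (g x) 0 := by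
  choose! g hg0 hg using fun (x : H) (hx : x ≠ 0) => h.exists_rankOne_zero (𝕜 := 𝕜) hx
  refine ⟨g, ⟨hg0, fun x y z hx hy hz => ?_, fun y hy => ?_⟩, hg⟩
  · rw [mem_span_pair_iff hx hy hz, mem_span_pair_iff (hg0 x hx) (hg0 y hy) (hg0 z hz),
      ← hg x hx, ← hg y hy, ← hg z hz]
    refine ⟨fun H A => ?_, fun H A => ?_⟩
    · obtain ⟨A, rfl⟩ := h.1.2 A
      rw [← h.2, ← h.2, ← h.2]
      exact H A
    · rw [h.2, h.2 (rankOne 𝕜 y 0), h.2 (rankOne 𝕜 z 0)]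
      exact H (φ A)
  · obtain ⟨x, hx, hxy⟩ := h.symm.exists_rankOne_zero hy
    have h1 : rankOne 𝕜 y 0 = rankOne 𝕜 (g x) 0 := by rw [← hg x hx, ← hxy, h.apply_inv]
    obtain ⟨c, hc⟩ := Submodule.mem_span_singleton.1 (mem_span_of_rankOne_le hy h1.le)
    exact ⟨x, hx, c, hc.symm⟩

theorem exists_semilinear [CompleteSpace H] (h : IsOrderAutomorphism φ)
    (hdim : 3 ≤ Module.rank 𝕜 H) :
    ∃ (σ : 𝕜 →+* 𝕜) (S : H →ₛₗ[σ] H), Function.Bijective σ ∧ Function.Bijective S ∧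
      ∀ x, x ≠ 0 → φ (rankOne 𝕜 x 0) = rankOne 𝕜 (S x) 0 := by
  obtain ⟨g, hg, hφ⟩ := h.exists_isCollineation
  obtain ⟨σ, S, hσ, hS, hSg⟩ := hg.exists_semilinear hdim
  refine ⟨σ, S, hσ, hS, fun x hx => ?_⟩
  obtain ⟨c, hc, hcx⟩ := hSg x hx
  have := rankOne_smul hc (g x) 0
  rw [mul_zero] at this
  rw [hcx, this, hφ x hx]

/-! ### The transformation of energies. -/

section Energy

variable {σ : 𝕜 →+* 𝕜} {S : H →ₛₗ[σ] H}

/-- For fixed `x`, the effects `rankOne 𝕜 x u` form a chain below `rankOne 𝕜 x 0`, decreasing in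
`u`, and `φ` maps this chain onto the one of `S x`. -/
theorem exists_energy (h : IsOrderAutomorphism φ) (hS : Function.Injective S)
    (hφ : ∀ x, x ≠ 0 → φ (rankOne 𝕜 x 0) = rankOne 𝕜 (S x) 0) :
    ∃ G : H → NNReal → NNReal, ∀ x, x ≠ 0 →
      (∀ u, φ (rankOne 𝕜 x u) = rankOne 𝕜 (S x) (G x u)) ∧
      (∀ u u', G x u ≤ G x u' ↔ u ≤ u') ∧ Function.Surjective (G x) := by
  have hS0 : ∀ x, x ≠ 0 → S x ≠ 0 := fun x hx h => hx (hS (h.trans (map_zero S).symm))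
  have h1 : ∀ (x : H) (u : NNReal), ∃ w, x ≠ 0 → φ (rankOne 𝕜 x u) = rankOne 𝕜 (S x) w := by
    intro x u
    by_cases hx : x = 0
    · exact ⟨0, fun h => (h hx).elim⟩
    obtain ⟨y, w, hy, hw⟩ := h.exists_rankOne hx u
    have hle : φ (rankOne 𝕜 x u) ≤ φ (rankOne 𝕜 x 0) := by
      rw [← h.2, rankOne_le_rankOne_iff hx]; exact zero_le
    rw [hw, hφ x hx] at hle
    obtain ⟨w', hw'⟩ := exists_eq_rankOne_of_le hy hle
    exact ⟨w', fun _ => hw.trans hw'⟩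
  choose G hG using h1
  refine ⟨G, fun x hx => ⟨fun u => hG x u hx, fun u u' => ?_, fun w => ?_⟩⟩
  · rw [← rankOne_le_rankOne_iff (𝕜 := 𝕜) (hS0 x hx), ← hG x u hx, ← hG x u' hx, ← h.2,
      rankOne_le_rankOne_iff hx]
  · obtain ⟨y, u, hy, hu⟩ := h.symm.exists_rankOne (hS0 x hx) w
    have hu' : φ (rankOne 𝕜 y u) = rankOne 𝕜 (S x) w := by rw [← hu, h.apply_inv]
    have hle : rankOne 𝕜 y u ≤ rankOne 𝕜 x 0 := by
      rw [h.2, hu', hφ x hx, rankOne_le_rankOne_iff (hS0 x hx)]; exact zero_le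
    obtain ⟨u', hu''⟩ := exists_eq_rankOne_of_le hy hle
    refine ⟨u', ?_⟩
    rw [hu'', hG x u' hx] at hu'
    exact le_antisymm ((rankOne_le_rankOne_iff (hS0 x hx)).1 hu'.ge)
      ((rankOne_le_rankOne_iff (hS0 x hx)).1 hu'.le)

/-- The images of the effects `(I + a ⊗ a*)⁻¹` are of the same form. -/
theorem exists_map_invOneAdd (h : IsOrderAutomorphism φ) (hS : Function.Bijective S)
    (hφ : ∀ x, x ≠ 0 → φ (rankOne 𝕜 x 0) = rankOne 𝕜 (S x) 0) {G : H → NNReal → NNReal}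
    (hG : ∀ x, x ≠ 0 → ∀ u, φ (rankOne 𝕜 x u) = rankOne 𝕜 (S x) (G x u)) {a : H} (ha : a ≠ 0) :
    ∃ a', φ (invOneAdd 𝕜 a) = invOneAdd 𝕜 a' := by
  set C := φ (invOneAdd 𝕜 a) with hC
  have hS0 : ∀ x, x ≠ 0 → S x ≠ 0 := fun x hx h => hx (hS.1 (h.trans (map_zero S).symm))
  have ha' : (‖a‖ : 𝕜) ≠ 0 := by simpa using ha
  -- The fixed vectors of `C` are the images of the hyperplane orthogonal to `a`, so `I - C` has
  -- rank one.
  have hfix : ∀ x, x ≠ 0 → (C.1 (S x) = S x ↔ ⟪a, x⟫_𝕜 = 0) := by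
    intro x hx
    rw [← rankOne_zero_le_iff (hS0 x hx), ← hφ x hx, hC, ← h.2, rankOne_le_invOneAdd_iff hx,
      NNReal.coe_zero, ← norm_eq_zero]
    exact ⟨fun h => pow_eq_zero_iff two_ne_zero |>.1 (le_antisymm h (sq_nonneg _)),
      fun h => by rw [h]; simp⟩
  set d := (1 - C.1) (S a) with hd
  have hd0 : d ≠ 0 := by
    intro h0
    rw [hd, sub_apply, one_apply_eq_self, sub_eq_zero, eq_comm, hfix a ha] at h0
    exact ha (inner_self_eq_zero.1 h0)
  have hspan : ∀ y, (1 - C.1) y ∈ Submodule.span 𝕜 {d} := by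
    intro y
    obtain ⟨x, rfl⟩ := hS.2 y
    set n := x - (⟪a, x⟫_𝕜 / (‖a‖ : 𝕜) ^ 2) • a with hn
    have han : ⟪a, n⟫_𝕜 = 0 := by
      rw [hn, inner_sub_right, inner_smul_right, inner_self_eq_norm_sq_to_K]
      field_simp
      simp
    have hn' : (1 - C.1) (S n) = 0 := by
      by_cases hn0 : n = 0
      · rw [hn0, map_zero, map_zero]
      · rw [sub_apply, one_apply_eq_self, (hfix n hn0).2 han, sub_self]
    have hx : x = n + (⟪a, x⟫_𝕜 / (‖a‖ : 𝕜) ^ 2) • a := by rw [hn]; abel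
    rw [hx, map_add, map_add, hn', zero_add, map_smulₛₗ, map_smul]
    exact Submodule.smul_mem _ _ (Submodule.mem_span_singleton_self d)
  have hpos := isPositive_one_sub C
  have hrank := eq_smul_rankOne_of_apply_eq_zero hpos.isSymmetric hd0
    (apply_eq_zero_of_range_subset_span hpos.isSymmetric hspan)
  set r : ℝ := RCLike.re ⟪(1 - C.1) d, d⟫_𝕜 / ‖d‖ ^ 4 with hr
  have hr0 : 0 ≤ r := div_nonneg (hpos.re_inner_nonneg_left d) (by positivity)
  have hd' : 0 < ‖d‖ := norm_pos_iff.2 hd0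
  have hrd : RCLike.re ⟪(1 - C.1) d, d⟫_𝕜 = r * ‖d‖ ^ 4 := by rw [hr]; field_simp
  refine eq_invOneAdd hr0 (lt_of_le_of_ne ?_ ?_) hrank
  · have h1 := (isPositive C).re_inner_nonneg_left d
    rw [sub_apply, one_apply_eq_self, inner_sub_left, map_sub, inner_self_eq_norm_sq] at hrd
    have h2 : 0 < ‖d‖ ^ 2 := by positivity
    refine le_of_mul_le_mul_right ?_ h2
    nlinarith
  -- Otherwise the form of `C` vanishes at `d`. But `C` dominates a rank one effect along `S a`, so
  -- `S a` is orthogonal to `d` and `(I - C) (S a) = 0`.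
  · intro h1
    have hCd : RCLike.re ⟪C.1 d, d⟫_𝕜 = 0 := by
      rw [sub_apply, one_apply_eq_self, inner_sub_left, map_sub, inner_self_eq_norm_sq] at hrd
      linear_combination -hrd + (-‖d‖ ^ 2) * h1
    have h2 : rankOne 𝕜 a (‖⟪a, a⟫_𝕜‖₊ ^ 2) ≤ invOneAdd 𝕜 a := by
      rw [rankOne_le_invOneAdd_iff ha]; simp
    rw [h.2, hG a ha, rankOne_le_iff (hS0 a ha)] at h2
    have h3 := h2 d
    rw [← hC, hCd, mul_zero] at h3
    have h4 : ⟪S a, d⟫_𝕜 = 0 := by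
      rw [← norm_eq_zero]
      exact pow_eq_zero_iff two_ne_zero |>.1 (le_antisymm h3 (sq_nonneg _))
    refine hd0 (hd.trans ?_)
    rw [hrank, smul_apply, InnerProductSpace.rankOne_apply, inner_eq_zero_symm.1 h4]
    simp

/-- The zeros of `⟪a, x⟫` and `⟪a', S x⟫` agree, being the vectors where the test effects have zero
energy. Hence `⟪a', S x⟫ = m * σ ⟪a, x⟫`, and `k = ‖m‖²`. -/
theorem exists_energy_inner (h : IsOrderAutomorphism φ) (hS : Function.Bijective S)
    (hφ : ∀ x, x ≠ 0 → φ (rankOne 𝕜 x 0) = rankOne 𝕜 (S x) 0) {G : H → NNReal → NNReal}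
    (hG : ∀ x, x ≠ 0 → (∀ u, φ (rankOne 𝕜 x u) = rankOne 𝕜 (S x) (G x u)) ∧
      (∀ u u', G x u ≤ G x u' ↔ u ≤ u') ∧ Function.Surjective (G x)) {a : H} (ha : a ≠ 0) :
    ∃ k : NNReal, 0 < k ∧ ∀ x, x ≠ 0 →
      G x (‖⟪a, x⟫_𝕜‖₊ ^ 2) = k * ‖σ ⟪a, x⟫_𝕜‖₊ ^ 2 := by
  obtain ⟨a', ha'⟩ := h.exists_map_invOneAdd hS hφ (fun x hx => (hG x hx).1) ha
  have hS0 : ∀ x, x ≠ 0 → S x ≠ 0 := fun x hx h => hx (hS.1 (h.trans (map_zero S).symm))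
  have han : (‖a‖ : 𝕜) ≠ 0 := by simpa using ha
  have hle : ∀ x, x ≠ 0 → ∀ u : NNReal, ‖⟪a, x⟫_𝕜‖₊ ^ 2 ≤ u ↔ ‖⟪a', S x⟫_𝕜‖₊ ^ 2 ≤ G x u := by
    intro x hx u
    have h1 := rankOne_le_invOneAdd_iff (𝕜 := 𝕜) (a := a) hx (u := u)
    have h2 := rankOne_le_invOneAdd_iff (𝕜 := 𝕜) (a := a') (hS0 x hx) (u := G x u)
    rw [← ha', ← (hG x hx).1, ← h.2, h1] at h2
    exact_mod_cast h2
  have heq : ∀ x, x ≠ 0 → G x (‖⟪a, x⟫_𝕜‖₊ ^ 2) = ‖⟪a', S x⟫_𝕜‖₊ ^ 2 := by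
    intro x hx
    refine le_antisymm ?_ ((hle x hx _).1 le_rfl)
    obtain ⟨u, hu⟩ := (hG x hx).2.2 (‖⟪a', S x⟫_𝕜‖₊ ^ 2)
    rw [← hu, (hG x hx).2.1]
    exact (hle x hx u).2 hu.ge
  have hzero : ∀ x, x ≠ 0 → (⟪a, x⟫_𝕜 = 0 ↔ ⟪a', S x⟫_𝕜 = 0) := by
    intro x hx
    have h0 : G x 0 = 0 := by
      obtain ⟨u, hu⟩ := (hG x hx).2.2 0
      have h0u : G x 0 ≤ G x u := ((hG x hx).2.1 0 u).2 zero_le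
      rw [hu] at h0u
      exact le_antisymm h0u zero_le
    have := hle x hx 0
    rw [h0] at this
    simpa using this
  set m : 𝕜 := ⟪a', S a⟫_𝕜 / σ ((‖a‖ : 𝕜) ^ 2) with hm
  have hσa : σ ((‖a‖ : 𝕜) ^ 2) ≠ 0 := (map_ne_zero σ).2 (pow_ne_zero 2 han)
  have hm0 : m ≠ 0 := by
    refine div_ne_zero (fun h0 => ha ?_) hσa
    exact inner_self_eq_zero.1 ((hzero a ha).2 h0)
  refine ⟨‖m‖₊ ^ 2, pow_pos (nnnorm_pos.2 hm0) 2, fun x hx => ?_⟩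
  rw [heq x hx, ← mul_pow, ← nnnorm_mul]
  congr 2
  set n := x - (⟪a, x⟫_𝕜 / (‖a‖ : 𝕜) ^ 2) • a with hn
  have han' : ⟪a, n⟫_𝕜 = 0 := by
    rw [hn, inner_sub_right, inner_smul_right, inner_self_eq_norm_sq_to_K]
    field_simp
    simp
  have hn' : ⟪a', S n⟫_𝕜 = 0 := by
    by_cases hn0 : n = 0
    · rw [hn0, map_zero, inner_zero_right]
    · exact (hzero n hn0).1 han'
  rw [hn, map_sub, map_smulₛₗ, inner_sub_right, inner_smul_right, sub_eq_zero] at hn'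
  rw [hn', hm, map_div₀]
  ring

end Energy

end IsOrderAutomorphism

/-! ### Normalization, boundedness and the passage to all effects. -/

namespace IsOrderAutomorphism

open effects

variable {𝕜 H : Type*} [RCLike 𝕜] [NormedAddCommGroup H] [InnerProductSpace 𝕜 H]

theorem exists_inner_eq_one {x y : H} (hx : x ≠ 0) (hxy : y ∉ Submodule.span 𝕜 {x}) :
    ∃ a : H, ⟪a, x⟫_𝕜 = 1 ∧ ⟪a, y⟫_𝕜 = 1 := by
  have hxn : (‖x‖ : 𝕜) ≠ 0 := by simpa using hx
  set z := y - (⟪x, y⟫_𝕜 / (‖x‖ : 𝕜) ^ 2) • x with hz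
  have hz0 : z ≠ 0 := fun h0 => hxy
    (Submodule.mem_span_singleton.2 ⟨_, (sub_eq_zero.1 (hz.symm.trans h0)).symm⟩)
  have hzn : (‖z‖ : 𝕜) ≠ 0 := by simpa using hz0
  have hxz : ⟪x, z⟫_𝕜 = 0 := by
    rw [hz, inner_sub_right, inner_smul_right, inner_self_eq_norm_sq_to_K]
    field_simp
    simp
  have hzx : ⟪z, x⟫_𝕜 = 0 := inner_eq_zero_symm.1 hxz
  have hzy : ⟪z, y⟫_𝕜 = (‖z‖ : 𝕜) ^ 2 := by
    have hy : y = z + (⟪x, y⟫_𝕜 / (‖x‖ : 𝕜) ^ 2) • x := by rw [hz]; abel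
    rw [hy, inner_add_right, inner_smul_right, hzx, inner_self_eq_norm_sq_to_K]; ring
  refine ⟨((starRingEnd 𝕜) ((‖x‖ : 𝕜) ^ 2)⁻¹) • x +
    ((starRingEnd 𝕜) ((1 - ((‖x‖ : 𝕜) ^ 2)⁻¹ * ⟪x, y⟫_𝕜) / (‖z‖ : 𝕜) ^ 2)) • z, ?_, ?_⟩
  · rw [inner_add_left, inner_smul_left, inner_smul_left, RCLike.conj_conj, hzx,
      inner_self_eq_norm_sq_to_K, mul_zero, add_zero, inv_mul_cancel₀ (pow_ne_zero 2 hxn)]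
  · rw [inner_add_left, inner_smul_left, inner_smul_left, RCLike.conj_conj, RCLike.conj_conj, hzy,
      div_mul_cancel₀ _ (pow_ne_zero 2 hzn)]
    ring

theorem exists_inner_eq {x : H} (hx : x ≠ 0) (c : 𝕜) : ∃ a : H, ⟪a, x⟫_𝕜 = c := by
  have hxn : (‖x‖ : 𝕜) ≠ 0 := by simpa using hx
  refine ⟨(starRingEnd 𝕜) (c / (‖x‖ : 𝕜) ^ 2) • x, ?_⟩
  rw [inner_smul_left, RCLike.conj_conj, inner_self_eq_norm_sq_to_K,
    div_mul_cancel₀ _ (pow_ne_zero 2 hxn)]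

/-- The transformation of energies under an order automorphism does not depend on the vector. -/
theorem exists_energy_const (hdim : 3 ≤ Module.rank 𝕜 H) {σ : 𝕜 →+* 𝕜}
    {G : H → NNReal → NNReal}
    (hG0 : ∀ x, x ≠ 0 → G x 0 = 0)
    (h : ∀ a : H, a ≠ 0 → ∃ k : NNReal, 0 < k ∧ ∀ x, x ≠ 0 →
      G x (‖⟪a, x⟫_𝕜‖₊ ^ 2) = k * ‖σ ⟪a, x⟫_𝕜‖₊ ^ 2) :
    ∃ k : NNReal, 0 < k ∧ ∀ x, x ≠ 0 → ∀ c : 𝕜, G x (‖c‖₊ ^ 2) = k * ‖σ c‖₊ ^ 2 := by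
  have hane : ∀ {a x : H} {c : 𝕜}, c ≠ 0 → ⟪a, x⟫_𝕜 = c → a ≠ 0 := by
    rintro a x c hc h1 rfl
    exact hc (by rw [← h1, inner_zero_left])
  have hone : ∀ (a x : H) (k : NNReal), x ≠ 0 → ⟪a, x⟫_𝕜 = 1 → (∀ x, x ≠ 0 →
      G x (‖⟪a, x⟫_𝕜‖₊ ^ 2) = k * ‖σ ⟪a, x⟫_𝕜‖₊ ^ 2) → G x 1 = k := by
    intro a x k hx hax hk
    have := hk x hx
    simpa [hax] using this
  -- Independent vectors share an `a` pairing to one with both.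
  have hindep : ∀ x y : H, x ≠ 0 → y ∉ Submodule.span 𝕜 {x} → G x 1 = G y 1 := by
    intro x y hx hxy
    have hy : y ≠ 0 := by rintro rfl; simp at hxy
    obtain ⟨a, hax, hay⟩ := exists_inner_eq_one hx hxy
    obtain ⟨k, -, hk⟩ := h a (hane one_ne_zero hax)
    rw [hone a x k hx hax hk, hone a y k hy hay hk]
  obtain ⟨x₀, hx₀⟩ := IsCollineation.notMem_span_of_le_rank hdim (0 : H) 0
  have hx₀ : x₀ ≠ 0 := by rintro rfl; simp at hx₀
  have hconst : ∀ x, x ≠ 0 → G x 1 = G x₀ 1 := by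
    intro x hx
    by_cases hxx : x ∈ Submodule.span 𝕜 {x₀}
    · obtain ⟨z, hz⟩ := IsCollineation.notMem_span_of_le_rank hdim x₀ x₀
      rw [Set.pair_eq_singleton] at hz
      rw [hindep x₀ z hx₀ hz]
      refine hindep x z hx fun hzx => hz ?_
      exact (Submodule.span_singleton_le_iff_mem _ _).2 hxx hzx
    · exact (hindep x₀ x hx₀ hxx).symm
  obtain ⟨a₀, ha₀⟩ := exists_inner_eq hx₀ (1 : 𝕜)
  obtain ⟨k, hk0, hk⟩ := h a₀ (hane one_ne_zero ha₀)
  have hGk := hone a₀ x₀ k hx₀ ha₀ hk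
  refine ⟨k, hk0, fun x hx c => ?_⟩
  by_cases hc : c = 0
  · simp [hc, hG0 x hx]
  obtain ⟨a, ha⟩ := exists_inner_eq hx c
  have ha0 := hane hc ha
  obtain ⟨k', -, hk'⟩ := h a ha0
  have han : (‖a‖ : 𝕜) ≠ 0 := by simpa using ha0
  -- Evaluating at the multiple of `a` that pairs to one with `a` identifies the constant of `a`
  -- with `k`.
  have h1 : ⟪a, ((‖a‖ : 𝕜) ^ 2)⁻¹ • a⟫_𝕜 = 1 := by
    rw [inner_smul_right, inner_self_eq_norm_sq_to_K, inv_mul_cancel₀ (pow_ne_zero 2 han)]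
  have hne : ((‖a‖ : 𝕜) ^ 2)⁻¹ • a ≠ 0 := smul_ne_zero (inv_ne_zero (pow_ne_zero 2 han)) ha0
  have h2 := hone a _ k' hne h1 hk'
  rw [hconst _ hne, hGk] at h2
  have h3 := hk' x hx
  rw [ha, ← h2] at h3
  exact h3

variable {φ : effects 𝕜 H → effects 𝕜 H}

/-- On rank one effects an order automorphism is given by a bijective semilinear map. -/
theorem exists_map_rankOne [CompleteSpace H] (h : IsOrderAutomorphism φ)
    (hdim : 3 ≤ Module.rank 𝕜 H) :
    ∃ (σ : 𝕜 →+* 𝕜) (_ : IsIdOrConj σ) (T : H →ₛₗ[σ] H), Function.Bijective T ∧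
      ∀ x, x ≠ 0 → ∀ u, φ (rankOne 𝕜 x u) = rankOne 𝕜 (T x) u := by
  obtain ⟨σ, S, -, hS, hφ⟩ := h.exists_semilinear hdim
  obtain ⟨G, hG⟩ := h.exists_energy hS.1 hφ
  have hG0 : ∀ x, x ≠ 0 → G x 0 = 0 := by
    intro x hx
    obtain ⟨u, hu⟩ := (hG x hx).2.2 0
    have h0u : G x 0 ≤ G x u := ((hG x hx).2.1 0 u).2 zero_le
    rw [hu] at h0u
    exact le_antisymm h0u zero_le
  obtain ⟨k, hk0, hk⟩ := exists_energy_const hdim hG0 fun a ha =>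
    h.exists_energy_inner hS hφ hG ha
  obtain ⟨x₀, hx₀⟩ := IsCollineation.notMem_span_of_le_rank hdim (0 : H) 0
  have hx₀ : x₀ ≠ 0 := by rintro rfl; simp at hx₀
  have hnorm : ∀ c, ‖σ c‖ = ‖c‖ := by
    refine norm_map_eq_of_norm_le_iff fun c d => ?_
    have h1 := (hG x₀ hx₀).2.1 (‖c‖₊ ^ 2) (‖d‖₊ ^ 2)
    rw [hk x₀ hx₀, hk x₀ hx₀, mul_le_mul_iff_right₀ hk0,
      pow_le_pow_iff_left₀ zero_le zero_le two_ne_zero,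
      pow_le_pow_iff_left₀ zero_le zero_le two_ne_zero] at h1
    exact h1.symm
  have hσ := isIdOrConj_of_norm_map hnorm
  have hGk : ∀ x, x ≠ 0 → ∀ u, G x u = k * u := by
    intro x hx u
    have h1 := hk x hx ((NNReal.sqrt u : ℝ) : 𝕜)
    have h2 : ‖((NNReal.sqrt u : ℝ) : 𝕜)‖₊ = NNReal.sqrt u := by
      apply NNReal.eq
      rw [coe_nnnorm, RCLike.norm_ofReal, NNReal.abs_eq]
    have h3 : ‖σ ((NNReal.sqrt u : ℝ) : 𝕜)‖₊ = NNReal.sqrt u := by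
      have h4 : ‖σ ((NNReal.sqrt u : ℝ) : 𝕜)‖₊ = ‖((NNReal.sqrt u : ℝ) : 𝕜)‖₊ :=
        NNReal.eq (hnorm _)
      exact h4.trans h2
    rwa [h3, h2, NNReal.sq_sqrt] at h1
  -- Energies are quadratic, so dividing `S` by `√k` absorbs the factor `k`.
  set κ : 𝕜 := ((NNReal.sqrt k : ℝ) : 𝕜) with hκ
  have hκn : ‖κ‖₊ ^ 2 = k := by
    have : ‖κ‖₊ = NNReal.sqrt k := by
      apply NNReal.eq
      rw [coe_nnnorm, RCLike.norm_ofReal, NNReal.abs_eq]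
    rw [this, NNReal.sq_sqrt]
  have hκ0 : κ ≠ 0 := by
    intro h0
    rw [h0] at hκn
    simp at hκn
    exact hk0.ne hκn
  refine ⟨σ, hσ, κ⁻¹ • S, ⟨fun x y hxy => hS.1 ?_, fun y => ?_⟩, fun x hx u => ?_⟩
  · exact smul_right_injective H (inv_ne_zero hκ0) hxy
  · obtain ⟨x, hx⟩ := hS.2 (κ • y)
    exact ⟨x, by rw [LinearMap.smul_apply, hx, smul_smul, inv_mul_cancel₀ hκ0, one_smul]⟩
  · have h1 := rankOne_smul hκ0 (κ⁻¹ • S x) u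
    rw [smul_smul, mul_inv_cancel₀ hκ0, one_smul, hκn] at h1
    rw [(hG x hx).1, hGk x hx, h1, LinearMap.smul_apply]

/-- An effect which dominates a positive multiple of every rank one projection is bounded below. -/
theorem exists_norm_sq_le [CompleteSpace H] {B : effects 𝕜 H}
    (hB : ∀ y, y ≠ 0 → ∃ u, rankOne 𝕜 y u ≤ B) :
    ∃ C : NNReal, ∀ v, ‖v‖ ^ 2 ≤ C * RCLike.re ⟪B.1 v, v⟫_𝕜 := by
  have hpos : ∀ v, v ≠ 0 → 0 < RCLike.re ⟪B.1 v, v⟫_𝕜 := by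
    intro v hv
    obtain ⟨u, hu⟩ := hB v hv
    have h1 := (rankOne_le_iff hv).1 hu v
    have h2 : ⟪v, v⟫_𝕜 ≠ 0 := inner_self_ne_zero.2 hv
    have h3 : 0 < ‖⟪v, v⟫_𝕜‖ ^ 2 := by positivity
    exact pos_of_mul_pos_right (h3.trans_le h1) (normSq_add_pos hv u).le
  -- The functionals `⟪v, ·⟫`, normalized by the form of `B`, are pointwise bounded by hypothesis;
  -- uniform boundedness then gives the constant.
  let F : H → StrongDual 𝕜 H := fun v =>
    (((Real.sqrt (RCLike.re ⟪B.1 v, v⟫_𝕜))⁻¹ : ℝ) : 𝕜) • innerSL 𝕜 v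
  obtain ⟨C, hC⟩ : ∃ C, ∀ v, ‖F v‖ ≤ C := by
    refine banach_steinhaus fun y => ?_
    by_cases hy : y = 0
    · exact ⟨0, fun v => by rw [hy, map_zero, norm_zero]⟩
    obtain ⟨u, hu⟩ := hB y hy
    refine ⟨Real.sqrt (‖y‖ ^ 2 + u), fun v => ?_⟩
    have h1 := (rankOne_le_iff hy).1 hu v
    change ‖(((Real.sqrt (RCLike.re ⟪B.1 v, v⟫_𝕜))⁻¹ : ℝ) : 𝕜) • ⟪v, y⟫_𝕜‖ ≤ _
    rw [norm_smul, RCLike.norm_ofReal, abs_of_nonneg (by positivity)]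
    by_cases hv : v = 0
    · rw [hv, inner_zero_left, norm_zero, mul_zero]; positivity
    have h2 := hpos v hv
    rw [inv_mul_le_iff₀ (Real.sqrt_pos.2 h2), ← Real.sqrt_mul h2.le]
    refine Real.le_sqrt_of_sq_le ?_
    rw [norm_inner_symm]
    linarith
  have hC0 : 0 ≤ C := (norm_nonneg _).trans (hC 0)
  refine ⟨Real.toNNReal (C ^ 2), fun v => ?_⟩
  rw [Real.coe_toNNReal _ (sq_nonneg C)]
  by_cases hv : v = 0
  · simp [hv]
  have h1 := hC v
  have h2 := hpos v hv
  rw [norm_smul, innerSL_apply_norm, RCLike.norm_ofReal, abs_of_nonneg (by positivity),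
    inv_mul_le_iff₀ (Real.sqrt_pos.2 h2)] at h1
  calc ‖v‖ ^ 2 ≤ (Real.sqrt (RCLike.re ⟪B.1 v, v⟫_𝕜) * C) ^ 2 := by gcongr
    _ = _ := by rw [mul_pow, Real.sq_sqrt h2.le]; ring

/-- The effect `φ (I / 2)` has energy `‖x‖²` at `T x`, while its lower bound keeps this energy below
`C ‖T x‖²`. So `T⁻¹` is bounded. -/
theorem exists_norm_sq_le_map [CompleteSpace H] (h : IsOrderAutomorphism φ) {σ : 𝕜 →+* 𝕜}
    {T : H →ₛₗ[σ] H} (hT : Function.Bijective T)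
    (hφ : ∀ x, x ≠ 0 → ∀ u, φ (rankOne 𝕜 x u) = rankOne 𝕜 (T x) u) :
    ∃ C : NNReal, ∀ x, ‖x‖ ^ 2 ≤ C * ‖T x‖ ^ 2 := by
  have hT0 : ∀ x, x ≠ 0 → T x ≠ 0 := fun x hx h => hx (hT.1 (h.trans (map_zero T).symm))
  obtain ⟨C, hC⟩ := exists_norm_sq_le (B := φ (half 𝕜 H)) fun y hy => by
    obtain ⟨x, rfl⟩ := hT.2 y
    have hx : x ≠ 0 := by rintro rfl; exact hy (map_zero T)
    refine ⟨‖x‖₊ ^ 2, ?_⟩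
    rw [← hφ x hx, ← h.2, rankOne_le_half_iff hx]
    simp
  refine ⟨C, fun x => ?_⟩
  by_cases hx : x = 0
  · simp [hx]
  have h1 : rankOne 𝕜 (T x) (C * ‖T x‖₊ ^ 2) ≤ φ (half 𝕜 H) := by
    rw [rankOne_le_iff (hT0 x hx)]
    intro v
    have h2 := norm_inner_le_norm (𝕜 := 𝕜) (T x) v
    have h3 := (isPositive (φ (half 𝕜 H))).re_inner_nonneg_left v
    calc ‖⟪T x, v⟫_𝕜‖ ^ 2 ≤ (‖T x‖ * ‖v‖) ^ 2 := by gcongr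
      _ = ‖T x‖ ^ 2 * ‖v‖ ^ 2 := by ring
      _ ≤ ‖T x‖ ^ 2 * (C * RCLike.re ⟪(φ (half 𝕜 H)).1 v, v⟫_𝕜) := by gcongr; exact hC v
      _ = 0 * RCLike.re ⟪(φ (half 𝕜 H)).1 v, v⟫_𝕜 +
          (C * ‖T x‖ ^ 2) * RCLike.re ⟪(φ (half 𝕜 H)).1 v, v⟫_𝕜 := by ring
      _ ≤ ‖T x‖ ^ 2 * RCLike.re ⟪(φ (half 𝕜 H)).1 v, v⟫_𝕜 +
          (C * ‖T x‖ ^ 2) * RCLike.re ⟪(φ (half 𝕜 H)).1 v, v⟫_𝕜 := by gcongr; positivity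
      _ = _ := by push_cast; ring
  rw [← hφ x hx, ← h.2, rankOne_le_half_iff hx] at h1
  exact_mod_cast h1

theorem exists_eq_effectAut [CompleteSpace H] (h : IsOrderAutomorphism φ)
    (hdim : 3 ≤ Module.rank 𝕜 H) :
    ∃ (σ : 𝕜 →+* 𝕜) (_ : IsIdOrConj σ) (T : H →SL[σ] H) (hT : Function.Bijective T),
      φ = effectAut hT := by
  obtain ⟨σ, hσ, T₀, hT₀, hφ⟩ := h.exists_map_rankOne hdim
  obtain ⟨C, hC⟩ := h.exists_norm_sq_le_map hT₀ hφ
  let e : H ≃ₛₗ[σ] H := LinearEquiv.ofBijective T₀ hT₀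
  have hsymm : Continuous e.symm := by
    refine AddMonoidHomClass.continuous_of_bound e.symm (Real.sqrt C) fun y => ?_
    have h1 := hC (e.symm y)
    have h2 : T₀ (e.symm y) = y := e.apply_symm_apply y
    rw [h2] at h1
    calc ‖e.symm y‖ = Real.sqrt (‖e.symm y‖ ^ 2) := (Real.sqrt_sq (norm_nonneg _)).symm
      _ ≤ Real.sqrt (C * ‖y‖ ^ 2) := Real.sqrt_le_sqrt h1
      _ = Real.sqrt C * ‖y‖ := by
        rw [Real.sqrt_mul (NNReal.coe_nonneg C), Real.sqrt_sq (norm_nonneg _)]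
  -- The open mapping theorem turns boundedness of the inverse into that of `T₀`.
  have hcont : Continuous T₀ := LinearEquiv.continuous_symm e.symm hsymm
  let T : H →SL[σ] H := ⟨T₀, hcont⟩
  have hT : Function.Bijective T := hT₀
  refine ⟨σ, hσ, T, hT, ?_⟩
  have haut := isOrderAutomorphism_effectAut hT
  have key : ∀ X y u, y ≠ 0 → (rankOne 𝕜 y u ≤ φ X ↔ rankOne 𝕜 y u ≤ effectAut hT X) := by
    intro X y u hy
    obtain ⟨x, rfl⟩ := hT.2 y
    have hx : x ≠ 0 := by rintro rfl; exact hy (map_zero T)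
    have h1 : φ (rankOne 𝕜 x u) = rankOne 𝕜 (T x) u := hφ x hx u
    conv_lhs => rw [← h1]
    rw [← effectAut_rankOne hT hx, ← h.2, ← haut.2]
  funext X
  exact le_antisymm (le_of_forall_rankOne_le fun v u hv hu => (key X _ u hv).1 hu)
    (le_of_forall_rankOne_le fun v u hv hu => (key X _ u hv).2 hu)

end IsOrderAutomorphism

theorem theorem3p1 {𝕜 H : Type*} [RCLike 𝕜] [NormedAddCommGroup H] [InnerProductSpace 𝕜 H]
    [CompleteSpace H] (hdim : 3 ≤ Module.rank 𝕜 H) :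
    -- `φ_T` is a well-defined map from `[0, I]` to `[0, I]`
    (∀ (σ : 𝕜 →+* 𝕜) [IsIdOrConj σ] (T : H →SL[σ] H), Function.Bijective T →
      ∀ X ∈ effects 𝕜 H, IsUnit (effectDenom T X) ∧ effectMap T X ∈ effects 𝕜 H) ∧
    -- the order automorphisms are exactly the maps `φ_T`
    (∀ φ : effects 𝕜 H → effects 𝕜 H,
      IsOrderAutomorphism φ ↔
        ∃ (σ : 𝕜 →+* 𝕜) (_ : IsIdOrConj σ) (T : H →SL[σ] H), Function.Bijective T ∧
          ∀ X : effects 𝕜 H, (φ X : H →L[𝕜] H) = effectMap T (X : H →L[𝕜] H)) ∧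
    -- `T` is determined by `φ_T` up to a scalar of modulus one
    (∀ (σ τ : 𝕜 →+* 𝕜) [IsIdOrConj σ] [IsIdOrConj τ] (T : H →SL[σ] H) (S : H →SL[τ] H),
      Function.Bijective T → Function.Bijective S →
      (∀ X ∈ effects 𝕜 H, effectMap T X = effectMap S X) →
        ∃ c : 𝕜, ‖c‖ = 1 ∧ ∀ x : H, T x = c • S x) := by
  refine ⟨fun σ _ T hT X hX => ⟨isUnit_effectDenom hT ⟨X, hX⟩, effectMap_mem hT ⟨X, hX⟩⟩,
    fun φ => ⟨fun h => ?_, ?_⟩, fun σ τ _ _ T S hT hS h => eq_smul_of_effectMap_eq hdim hT hS h⟩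
  · obtain ⟨σ, hσ, T, hT, rfl⟩ := h.exists_eq_effectAut hdim
    exact ⟨σ, hσ, T, hT, fun X => rfl⟩
  · rintro ⟨σ, hσ, T, hT, h⟩
    have hφ : φ = effectAut hT := funext fun X => Subtype.ext (h X)
    rw [hφ]
    exact isOrderAutomorphism_effectAut hT
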